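/- **Conventions.** Let $1\le d<n$. $B_r(y)$ is the open ball, $B^{\eta}=\{y: \operatorname{dist}(y,B)<\eta\}$, $\omega_d$ is the volume of the unit ball of $\mathbb R^d$. $G_{d,n}$ is the Grassmannian of $d$-dimensional subspaces $S$ of $\mathbb R^n$, identified with the orthogonal projections $\Pi_S$ onto them, with the operator norm distance $\|S-P\|$. For an open set $\Omega\subset\mathbb R^n$, a $d$-varifold $V$ in $\Omega$ is a non-negative Radon measure on $\Omega\times G_{d,n}$; its mass $\|V\|$ is its image on $\Omega$, and $V=\|V\|\otimes\{\nu_y\}_y$ is a disintegration into probability measures $\nu_y$ on $G_{d,n}$. For open $U\subset\Omega$, $$\Delta^{1,1}_U(\|V\|,\|W\|)=\sup\Big\{\Big|\int\varphi\,d\|V\|-\int\varphi\,d\|W\|\Big| : \varphi\in \mathrm{Lip}_1(\Omega),\ \|\varphi\|_\infty\le 1,\ \operatorname{supp}\varphi\subset U\Big\}.$$ The kernel profiles $\rho,\xi:\mathbb R\to[0,\infty)$ are even, supported in $[-1,1]$, with $\int_{\mathbb R^n}\rho(|y|)\,dy=\int_{\mathbb R^n}\xi(|y|)\,dy=1$,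 $\rho\in C^1\cap W^{2,\infty}$ and $\xi\in C^0\cap W^{1,\infty}$. Put $\rho_\epsilon(y)=\epsilon^{-n}\rho(|y|/\epsilon)$, $\xi_\epsilon(y)=\epsilon^{-n}\xi(|y|/\epsilon)$, $C_\rho=d\,\omega_d\int_0^1\rho(r)r^{d-1}dr$, $C_\xi=d\,\omega_d\int_0^1\xi(r)r^{d-1}dr$, and, where $\|V\|*\xi_\epsilon(x)>0$, $$H^{V}_{\rho,\xi,\epsilon}(x)=-\frac{C_\xi}{C_\rho}\,\frac{\int \Pi_S\nabla\rho_\epsilon(y-x)\,dV(y,S)}{\|V\|*\xi_\epsilon(x)},\qquad H^{V,\perp}_{\rho,\xi,\epsilon}(x)=\int_{G_{d,n}}\Pi_{P^\perp}\big(H^{V}_{\rho,\xi,\epsilon}(x)\big)\,d\nu_x(P).$$ **Theorem.** Let $\Omega\subset\mathbb R^n$ be open, let $M\subset\Omega$ be a $d$-dimensional submanifold of class $C^2$ without boundary, and let $V=v(M,1)=\mathcal H^d_{|M}\otimes\delta_{T_yM}$ be the associated $d$-varifold in $\Omega$ with multiplicity $1$ (its Young measure at $y\in M$ being $\delta_{T_yM}$).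 Let $y\mapsto\widetilde{T_yM}\in G_{d,n}$ be a $C^1$ extension of $y\mapsto T_yM$ to an open neighbourhood $N$ of $M$. Let $(V_i)_i$ be $d$-varifolds in $\Omega$, $V_i=\|V_i\|\otimes\{\nu^i_y\}_y$. Let $x\in M$ and let $z_i\in\operatorname{supp}\|V_i\|$ with $z_i\to x$. Let $(\eta_i)$, $(d_{1,i})$, $(d_{2,i})$, $(\epsilon_i)$ be positive, decreasing and infinitesimal sequences such that * there is a neighbourhood $U$ of $x$ such that for every $i$ and every ball $B\subset\Omega\cap U$ centered in $\operatorname{supp}\|V\|$, $$\Delta^{1,1}_B(\|V\|,\|V_i\|)\le d_{1,i}\min\big(\|V\|(B^{\eta_i}),\|V_i\|(B^{\eta_i})\big);$$ * for every $i$ and every $y\in B_{\epsilon_i+|x-z_i|}(x)\cap\operatorname{supp}\|V_i\|\cap N$, $$\int_{G_{d,n}}\|\widetilde{T_yM}-S\|\,d\nu^i_y(S)\le d_{2,i}.$$ (1) If $d_{1,i}+\eta_i+|x-z_i|=o(\epsilon_i)$ as $i\to\infty$, then $\|V_i\|*\xi_{\epsilon_i}(z_i)>0$ and $\|V\|*\xi_{\epsilon_i}(x)>0$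 for all large $i$, and there is $C>0$ such that, for every $i$ for which these two numbers are positive, $$\big|H^{V_i,\perp}_{\rho,\xi,\epsilon_i}(z_i)-H^{V,\perp}_{\rho,\xi,\epsilon_i}(x)\big|\le C\,\frac{d_{1,i}+d_{2,i}+|x-z_i|}{\epsilon_i}.$$ (2) If $d_{1,i}+d_{2,i}+\eta_i+|x-z_i|=o(\epsilon_i)$ as $i\to\infty$, then $H^{V_i,\perp}_{\rho,\xi,\epsilon_i}(z_i)\to H(x)$, where $H(x)$ is the mean curvature vector of $M$ at $x$ (the trace of the second fundamental form). -/

import Mathlib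

open MeasureTheory Filter Topology Set
open scoped ENNReal NNReal

noncomputable section

namespace VarifoldCurvature

/-- Euclidean space of dimension `n`. -/
abbrev E (n : ℕ) := EuclideanSpace ℝ (Fin n)

/-- The Grassmannian of `d`-dimensional subspaces of `ℝⁿ`; a subspace is identified with the
orthogonal projection onto it, and the distance is the operator norm of the difference. -/
def Gr (d n : ℕ) : Set (E n →L[ℝ] E n) :=
  {S | IsStarProjection S ∧ Module.finrank ℝ S.range = d}

/-- A `d`-varifold in `Ω`: a Radon measure on `Ω × Gr d n`, written as a Borel measure on
`ℝⁿ × L(ℝⁿ, ℝⁿ)` that is carried by `Ω × Gr d n` and finite on `K × Gr d n` for every compact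
`K ⊆ Ω` (the Grassmannian is compact). -/
structure Varifold (d n : ℕ) (Ω : Set (E n)) where
  measure : Measure (E n × (E n →L[ℝ] E n))
  carried : measure (Ω ×ˢ Gr d n)ᶜ = 0
  finite_on_compacts : ∀ K : Set (E n), IsCompact K → K ⊆ Ω → measure (K ×ˢ Gr d n) < ∞

variable {d n : ℕ} {Ω : Set (E n)}

/-- The mass `‖V‖`, the image of `V` under `(y, S) ↦ y`. -/
def Varifold.mass (V : Varifold d n Ω) : Measure (E n) := V.measure.map Prod.fst

/-- The support of `‖V‖` in `Ω`. -/
def Varifold.supp (V : Varifold d n Ω) : Set (E n) := V.mass.support ∩ Ω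

/-- `V = ‖V‖ ⊗ ν`: a Young measure representation of `V`, by probability measures `ν y` on the
Grassmannian that depend measurably on `y`. -/
structure IsYoungMeasure (V : Varifold d n Ω)
    (ν : ProbabilityTheory.Kernel (E n) (E n →L[ℝ] E n)) : Prop where
  isMarkov : ProbabilityTheory.IsMarkovKernel ν
  carried : ∀ y, ν y (Gr d n)ᶜ = 0
  disintegration : ∀ φ : E n × (E n →L[ℝ] E n) → ℝ≥0∞, Measurable φ →
    ∫⁻ p, φ p ∂V.measure = ∫⁻ y, ∫⁻ S, φ (y, S) ∂(ν y) ∂V.mass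

/-- Localized bounded Lipschitz distance `Δ^{1,1}_U(μ, ν)` of two measures on `Ω`: the supremum of
`|∫ φ dμ - ∫ φ dν|` over the `1`-Lipschitz `φ` on `Ω` with `|φ| ≤ 1` and support (the closure in
`Ω` of `{φ ≠ 0}`) contained in `U`. -/
def boundedLipschitzDist (Ω U : Set (E n)) (μ ν : Measure (E n)) : ℝ≥0∞ :=
  ⨆ φ ∈ {φ : E n → ℝ | LipschitzOnWith 1 φ Ω ∧ (∀ y ∈ Ω, |φ y| ≤ 1) ∧
      closure {y ∈ Ω | φ y ≠ 0} ∩ Ω ⊆ U},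
    ENNReal.ofReal |(∫ y in Ω, φ y ∂μ) - ∫ y in Ω, φ y ∂ν|

/-- `M` is an (embedded) `d`-dimensional submanifold of `ℝⁿ` of class `C²` without boundary:
locally the zero set of a `C²` submersion with values in `ℝ^{n-d}`. -/
def IsC2Submanifold (d : ℕ) {n : ℕ} (M : Set (E n)) : Prop :=
  ∀ p ∈ M, ∃ U : Set (E n), IsOpen U ∧ p ∈ U ∧ ∃ f : E n → E (n - d), ContDiffOn ℝ 2 f U ∧
    (∀ y ∈ U, Function.Surjective (fderiv ℝ f y)) ∧ M ∩ U = {y ∈ U | f y = 0}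

/-- The tangent space `T_yM`, spanned by (for a submanifold: consisting of) the velocities at `y`
of curves in `M`. -/
def tangentSpace (M : Set (E n)) (y : E n) : Submodule ℝ (E n) :=
  Submodule.span ℝ {v | ∃ γ : ℝ → E n, γ 0 = y ∧ (∀ᶠ t in 𝓝 0, γ t ∈ M) ∧ HasDerivAt γ v 0}

/-- The orthogonal projection onto `T_yM`. -/
def tangentProj (M : Set (E n)) (y : E n) : E n →L[ℝ] E n := (tangentSpace M y).starProjection

/-- The classical mean curvature vector of a `C²` submanifold `M` at `x`: the trace
`∑ₐ II(eₐ, eₐ)` over an orthonormal basis `(eₐ)` of `T_xM` of the second fundamental form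
`II(u, v) = (D_u Π) v`, `u, v ∈ T_xM`, where `Π_y` is the orthogonal projection onto `T_yM`.
For a curve `γ` in `M` through `x` with velocity `u`, `II(u, u)` is the normal part of its
acceleration, as one sees by differentiating `Π_γ γ' = γ'`. The trace is written with the
canonical basis of `ℝⁿ`, whose vectors are first projected to `T_xM`; the derivative along `M` is
only evaluated in tangential directions, where it is unique. -/
def meanCurvature (M : Set (E n)) (x : E n) : E n :=
  ∑ j : Fin n, fderivWithin ℝ (tangentProj M) M x (tangentProj M x (EuclideanSpace.single j 1))
    (tangentProj M x (EuclideanSpace.single j 1))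

/-- `V = v(M, 1)`: the measure `V` is `ℋ^d` restricted to `M`, tensored with the Dirac masses at
`T_yM`. Here `μHE[d]` is the `d`-dimensional Hausdorff measure normalized as the Lebesgue measure
on `d`-dimensional subspaces. -/
def IsUnitDensityVarifold (V : Varifold d n Ω) (M : Set (E n)) : Prop :=
  V.measure = ((μHE[d] : Measure (E n)).restrict M).map (fun y => (y, tangentProj M y))

/-- The assumptions on the pair `(ρ, ξ)` of kernel profiles: even, nonnegative, supported in
`[-1, 1]`, with normalized radial kernels on `ℝⁿ`, and `ρ` of class `C¹` and `W^{2,∞}`, `ξ`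
continuous and of class `W^{1,∞}`. -/
structure IsKernelPair (n : ℕ) (ρ ξ : ℝ → ℝ) : Prop where
  rho_nonneg : ∀ t, 0 ≤ ρ t
  xi_nonneg : ∀ t, 0 ≤ ξ t
  rho_even : ∀ t, ρ (-t) = ρ t
  xi_even : ∀ t, ξ (-t) = ξ t
  rho_support : tsupport ρ ⊆ Icc (-1) 1
  xi_support : tsupport ξ ⊆ Icc (-1) 1
  rho_integral : ∫ y : E n, ρ ‖y‖ = 1
  xi_integral : ∫ y : E n, ξ ‖y‖ = 1
  rho_contDiff : ContDiff ℝ 1 ρ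
  rho_deriv_lipschitz : ∃ K : ℝ≥0, LipschitzWith K (deriv ρ)
  xi_lipschitz : ∃ K : ℝ≥0, LipschitzWith K ξ

/-- The rescaled radial kernel `ρ_ε(y) = ε^{-n} ρ(|y| / ε)` on `ℝⁿ`. -/
def scaledKernel (ρ : ℝ → ℝ) (ε : ℝ) (y : E n) : ℝ := (ε ^ n)⁻¹ * ρ (‖y‖ / ε)

/-- `C_ρ = d ω_d ∫₀¹ ρ(r) r^{d-1} dr`, with `ω_d` the volume of the unit ball of `ℝ^d`. -/
def kernelConst (d : ℕ) (ρ : ℝ → ℝ) : ℝ :=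
  d * (volume (Metric.ball (0 : E d) 1)).toReal * ∫ r in (0 : ℝ)..1, ρ r * r ^ (d - 1)

/-- The regularized mass `(‖V‖ * ξ_ε)(x)`. -/
def regularizedMass (V : Varifold d n Ω) (ξ : ℝ → ℝ) (ε : ℝ) (x : E n) : ℝ :=
  ∫ y, scaledKernel ξ ε (x - y) ∂V.mass

/-- The regularized first variation `(δV * ρ_ε)(x) = ∫ ∇^S ρ_ε(y - x) dV(y, S)`, where
`∇^S = Π_S ∇`. -/
def regularizedFirstVariation (V : Varifold d n Ω) (ρ : ℝ → ℝ) (ε : ℝ) (x : E n) : E n :=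
  ∫ p, p.2 (gradient (scaledKernel ρ ε) (p.1 - x)) ∂V.measure

/-- The approximate mean curvature
`H^V_{ρ,ξ,ε}(x) = - (C_ξ / C_ρ) (δV * ρ_ε)(x) / (‖V‖ * ξ_ε)(x)`,
meaningful where `(‖V‖ * ξ_ε)(x) > 0`. -/
def approxMeanCurvature (V : Varifold d n Ω) (ρ ξ : ℝ → ℝ) (ε : ℝ) (x : E n) : E n :=
  -((kernelConst d ξ / kernelConst d ρ * (regularizedMass V ξ ε x)⁻¹) •
    regularizedFirstVariation V ρ ε x)

/-- The orthogonal approximate mean curvature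
`H^{V,⊥}_{ρ,ξ,ε}(x) = ∫ Π_{P^⊥} (H^V_{ρ,ξ,ε}(x)) dν_x(P)` of `V = ‖V‖ ⊗ ν`. -/
def orthApproxMeanCurvature (V : Varifold d n Ω) (ν : E n → Measure (E n →L[ℝ] E n))
    (ρ ξ : ℝ → ℝ) (ε : ℝ) (x : E n) : E n :=
  ∫ P, (approxMeanCurvature V ρ ξ ε x - P (approxMeanCurvature V ρ ξ ε x)) ∂(ν x)

end VarifoldCurvature

end

/-! Up to the constant C_ξ/C_ρ and a sign, the approximate curvature is ε⁻¹ β/α, where α is the mass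
tested with ξ(|y-x|/ε) and β the first variation tested with the unnormalized gradient of ρ; the
factors ε⁻ⁿ cancel (`approxMeanCurvature_eq`). Both kernels have Lipschitz constant of order 1/ε, so
exchanging V for V_i and x for z_i would in general cost a further factor 1/ε.

The normal projection Q = 1 - P, with P the projection onto T_xM, recovers this factor. Since QP =
0, the field QT = Q(T - P) is Lipschitz and vanishes at x, hence is O(ε) on the support of the
kernel. Its product with the rescaled gradient has a Lipschitz constant independent of ε, so with s
= d₁ + d₂ + |x - z| the error in Qβ is O(s ε^d), while Qβ itself is O(ε^{d+1}). The error in α is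
O(s ε^{d-1}) and α is at least of order ε^d, so the quotient multiplied by ε⁻¹ changes by O(s/ε).
Replacing Q by the average over the Young measure at z_i costs O(s) times the full approximate
curvature, which is O(1/ε). This is `norm_orthApproxMeanCurvature_sub_le`.

The orders of magnitude come from `blowUp`: rescalings of ℋ^d on M converge to Lebesgue measure on
T_xM. It is proved without an area formula, by charts that are bi-Lipschitz with constant K
arbitrarily close to 1, between which the Hausdorff measures differ by factors at most K^d.

For the convergence, the blow-up also gives ε^{-d} α → C_ξ and ε^{-d-1} Qβ → the integral over T_xM
of Q T'(u) ∇ρ(|u|), where T' is the derivative of T at x. Integration by parts turns this into -C_ρ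
times a trace (`integral_bilinear_radialGrad`). Differentiating T² = T shows that T'(u)v is normal
for tangent v, so the trace is the mean curvature (`sum_normal_fderiv_eq_meanCurvature`). -/

noncomputable section

namespace VarifoldCurvature

/-! ### Radial kernels, their gradients and their integrals -/

section Kernels

variable {F : Type*} [NormedAddCommGroup F] [InnerProductSpace ℝ F] {ρ : ℝ → ℝ}

/-- The gradient `(ρ'(|w|) / |w|) w` of the radial function `w ↦ ρ(|w|)`. -/
def radialGrad (ρ : ℝ → ℝ) (w : F) : F := (deriv ρ ‖w‖ * ‖w‖⁻¹) • w

lemma deriv_zero_of_even (h : ∀ t, ρ (-t) = ρ t) : deriv ρ 0 = 0 := by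
  have h1 := deriv_comp_neg (f := ρ) (x := 0)
  rw [funext h, neg_zero] at h1
  linarith

/-- The endpoint is included: the open set where f is nonzero lies in the interior of [-1, 1]. -/
lemma eq_zero_of_tsupport {f : ℝ → ℝ} (hf : Continuous f) (hs : tsupport f ⊆ Icc (-1) 1)
    {t : ℝ} (ht : 1 ≤ t) : f t = 0 := by
  by_contra h
  have h1 : Function.support f ⊆ interior (Icc (-1) 1) :=
    interior_maximal ((subset_tsupport f).trans hs) (hf.isOpen_support)
  rw [interior_Icc] at h1
  exact absurd (h1 h).2 (not_lt.2 ht)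

lemma abs_le_of_lipschitz_of_tsupport {f : ℝ → ℝ} {K : ℝ≥0} (hf : LipschitzWith K f)
    (hs : tsupport f ⊆ Icc (-1) 1) {t : ℝ} (ht : 0 ≤ t) : |f t| ≤ K := by
  rcases le_total 1 t with h | h
  · simp [eq_zero_of_tsupport hf.continuous hs h]
  · have h1 := hf.dist_le_mul t 1
    rw [Real.dist_eq, Real.dist_eq, eq_zero_of_tsupport hf.continuous hs le_rfl, sub_zero] at h1
    refine h1.trans ?_
    rw [abs_sub_comm, abs_of_nonneg (by linarith)]
    exact mul_le_of_le_one_right K.2 (by linarith)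

lemma norm_radialGrad (w : F) (h0 : deriv ρ 0 = 0) : ‖radialGrad ρ w‖ = |deriv ρ ‖w‖| := by
  unfold radialGrad
  rcases eq_or_ne w 0 with rfl | hw
  · simp [h0]
  · rw [norm_smul, norm_mul, norm_inv, norm_norm, mul_assoc,
      inv_mul_cancel₀ (norm_ne_zero_iff.2 hw), mul_one, Real.norm_eq_abs]

lemma hasFDerivAt_comp_norm (hρ : Differentiable ℝ ρ) (h0 : deriv ρ 0 = 0) (w : F) :
    HasFDerivAt (fun w : F => ρ ‖w‖) (innerSL ℝ (radialGrad ρ w)) w := by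
  rcases eq_or_ne w 0 with rfl | hw
  · have h1 : HasDerivAt ρ 0 0 := by simpa [h0] using (hρ 0).hasDerivAt
    have h2 : (fun t => ρ t - ρ 0) =o[𝓝 0] fun t => t := by
      simpa using h1.isLittleO
    have h3 : Tendsto (fun w : F => ‖w‖) (𝓝 0) (𝓝 0) := by simpa using tendsto_norm (x := (0:F))
    refine HasFDerivAt.of_isLittleO ?_
    have h4 := h2.comp_tendsto h3
    simp only [radialGrad, smul_zero, map_zero, norm_zero, sub_zero, zero_apply]
    exact h4.norm_right.congr_right (by simp) |>.of_norm_right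
  · have h1 : HasFDerivAt (fun w : F => ‖w‖) (‖w‖⁻¹ • innerSL ℝ w) w := by
      have h2 := (hasStrictFDerivAt_norm_sq w).hasFDerivAt.sqrt (by simpa using hw)
      simp only [Real.sqrt_sq (norm_nonneg _)] at h2
      refine h2.congr_fderiv ?_
      ext v
      simp
      field_simp
    have h2 := (hρ ‖w‖).hasDerivAt.comp_hasFDerivAt w h1
    refine h2.congr_fderiv ?_
    ext v
    simp [radialGrad]
    ring

lemma hasGradientAt_scaledKernel {n : ℕ} (hρ : Differentiable ℝ ρ) (h0 : deriv ρ 0 = 0) {ε : ℝ}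
    (hε : 0 < ε) (w : E n) :
    HasGradientAt (scaledKernel ρ ε) (((ε ^ n)⁻¹ * ε⁻¹) • radialGrad ρ (ε⁻¹ • w)) w := by
  have h1 : HasFDerivAt (fun w : E n => ε⁻¹ • w) (ε⁻¹ • ContinuousLinearMap.id ℝ (E n)) w :=
    (hasFDerivAt_id w).const_smul ε⁻¹
  have h2 := ((hasFDerivAt_comp_norm hρ h0 (ε⁻¹ • w)).comp w h1).const_mul ((ε ^ n)⁻¹)
  rw [hasGradientAt_iff_hasFDerivAt]
  refine (h2.congr_of_eventuallyEq (Eventually.of_forall fun y => ?_)).congr_fderiv ?_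
  · simp only [scaledKernel, Function.comp, norm_smul, norm_inv, Real.norm_eq_abs, abs_of_pos hε]
    rw [div_eq_inv_mul]
  · ext v
    simp
    ring

/-- Because ρ'(0) = 0, |ρ'(t)| ≤ Kt, which absorbs the singular factor 1/|w|. The difference splits
into the changes of the vector, of 1/|w| and of ρ', each at most K|u - v|; hence the 3. -/
lemma radialGrad_sub_le {K : ℝ≥0} (hK : LipschitzWith K (deriv ρ)) (h0 : deriv ρ 0 = 0)
    (u v : F) : ‖radialGrad ρ u - radialGrad ρ v‖ ≤ 3 * K * ‖u - v‖ := by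
  have hb : ∀ t : ℝ, 0 ≤ t → |deriv ρ t| ≤ K * t := fun t ht => by
    have := hK.dist_le_mul t 0
    rwa [Real.dist_eq, Real.dist_eq, h0, sub_zero, sub_zero, abs_of_nonneg ht] at this
  have hK0 : (0:ℝ) ≤ K := K.2
  rcases eq_or_ne u 0 with rfl | hu
  · have := hb ‖v‖ (norm_nonneg _)
    have hz : radialGrad ρ (0 : F) = 0 := by simp [radialGrad]
    rw [hz, zero_sub, norm_neg, norm_radialGrad v h0, zero_sub, norm_neg]
    nlinarith [norm_nonneg v, mul_nonneg hK0 (norm_nonneg v)]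
  rcases eq_or_ne v 0 with rfl | hv
  · have := hb ‖u‖ (norm_nonneg _)
    have hz : radialGrad ρ (0 : F) = 0 := by simp [radialGrad]
    rw [hz, sub_zero, norm_radialGrad u h0, sub_zero]
    nlinarith [norm_nonneg u, mul_nonneg hK0 (norm_nonneg u)]
  have hu' := norm_pos_iff.2 hu
  have hv' := norm_pos_iff.2 hv
  have e : radialGrad ρ u - radialGrad ρ v = (deriv ρ ‖u‖ * ‖u‖⁻¹) • (u - v)
      + (deriv ρ ‖u‖ * ‖u‖⁻¹ * ((‖v‖ - ‖u‖) * ‖v‖⁻¹)) • v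
      + ((deriv ρ ‖u‖ - deriv ρ ‖v‖) * ‖v‖⁻¹) • v := by
    unfold radialGrad
    rw [smul_sub, sub_add, sub_add, sub_right_inj, ← sub_smul, ← sub_smul]
    congr 1
    field_simp
    ring
  have hA : |deriv ρ ‖u‖ * ‖u‖⁻¹| ≤ K := by
    rw [abs_mul, abs_inv, abs_norm, ← div_eq_mul_inv, div_le_iff₀ hu']
    exact hb _ hu'.le
  have hn : |‖u‖ - ‖v‖| ≤ ‖u - v‖ := abs_norm_sub_norm_le u v
  have hn' : |‖v‖ - ‖u‖| ≤ ‖u - v‖ := by rwa [abs_sub_comm]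
  have hC : |deriv ρ ‖u‖ - deriv ρ ‖v‖| ≤ K * ‖u - v‖ := by
    have := hK.dist_le_mul ‖u‖ ‖v‖
    rw [Real.dist_eq, Real.dist_eq] at this
    exact this.trans (mul_le_mul_of_nonneg_left hn hK0)
  rw [e]
  refine (norm_add₃_le).trans ?_
  rw [norm_smul, norm_smul, norm_smul, Real.norm_eq_abs, Real.norm_eq_abs, Real.norm_eq_abs]
  have h1 : |deriv ρ ‖u‖ * ‖u‖⁻¹| * ‖u - v‖ ≤ K * ‖u - v‖ :=
    mul_le_mul_of_nonneg_right hA (norm_nonneg _)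
  have h2 : |deriv ρ ‖u‖ * ‖u‖⁻¹ * ((‖v‖ - ‖u‖) * ‖v‖⁻¹)| * ‖v‖ ≤ K * ‖u - v‖ := by
    rw [abs_mul, abs_mul (‖v‖ - ‖u‖), abs_inv, abs_norm, mul_assoc, mul_assoc,
      inv_mul_cancel₀ hv'.ne', mul_one]
    exact mul_le_mul hA hn' (abs_nonneg _) hK0
  have h3 : |(deriv ρ ‖u‖ - deriv ρ ‖v‖) * ‖v‖⁻¹| * ‖v‖ ≤ K * ‖u - v‖ := by
    rw [abs_mul, abs_inv, abs_norm, mul_assoc, inv_mul_cancel₀ hv'.ne', mul_one]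
    exact hC
  linarith

lemma tsupport_deriv_subset_Icc (hs : tsupport ρ ⊆ Icc (-1) 1) :
    tsupport (deriv ρ) ⊆ Icc (-1) 1 :=
  (closure_minimal support_deriv_subset (isClosed_tsupport ρ)).trans hs

lemma hasCompactSupport_comp_norm [FiniteDimensional ℝ F] {G : Type*} [Zero G] {f : F → G}
    (hf : ∀ w, 1 ≤ ‖w‖ → f w = 0) : HasCompactSupport f := by
  refine HasCompactSupport.intro (isCompact_closedBall (0 : F) 1) fun w hw => hf w ?_
  rw [mem_closedBall_zero_iff, not_le] at hw
  exact hw.le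

variable [FiniteDimensional ℝ F] [MeasurableSpace F] [BorelSpace F]

/-- Polar coordinates: the constants C_ρ and C_ξ are the integrals of the kernels over a tangent
space, which is how they enter the blow-up limits. -/
lemma integral_comp_norm {d : ℕ} (hd : 1 ≤ d) (hF : Module.finrank ℝ F = d) {f : ℝ → ℝ}
    (hf : ∀ t, 1 ≤ t → f t = 0) :
    ∫ u : F, f ‖u‖ = kernelConst d f := by
  have : Nontrivial F := Module.nontrivial_of_finrank_pos (R := ℝ) (by omega)
  rw [integral_fun_norm_addHaar, hF, kernelConst]
  have e1 : (volume : Measure F).real (Metric.ball 0 1) =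
      (volume (Metric.ball (0 : E d) 1)).toReal := by
    let e := (stdOrthonormalBasis ℝ F).reindex (finCongr hF)
    have := e.measurePreserving_repr.measure_preimage
      (s := Metric.ball (0 : E d) 1) Metric.isOpen_ball.measurableSet.nullMeasurableSet
    rw [measureReal_def, ← this]
    congr 2
    ext u
    simp
  rw [e1, nsmul_eq_mul, smul_eq_mul, mul_assoc]
  congr 2
  rw [intervalIntegral.integral_of_le zero_le_one]
  have e2 : ∀ t : ℝ, 1 < t → t ^ (d - 1) • f t = 0 := fun t ht => by simp [hf t ht.le]
  rw [setIntegral_eq_of_subset_of_forall_sdiff_eq_zero (s := Ioc (0 : ℝ) 1) measurableSet_Ioi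
    (fun t ht => ht.1) fun t ht => e2 t (not_le.1 fun h => ht.2 ⟨ht.1, h⟩)]
  simp only [smul_eq_mul, mul_comm]

/-- The normalization over ℝⁿ only serves to show that the profile is not identically zero; evenness
gives a nonzero value at some t ≥ 0, which is a norm in ℝ^d. -/
lemma kernelConst_pos {n d : ℕ} (hd : 1 ≤ d) {f : ℝ → ℝ} (hc : Continuous f)
    (hf0 : ∀ t, 0 ≤ f t) (he : ∀ t, f (-t) = f t) (hs : ∀ t, 1 ≤ t → f t = 0)
    (hi : ∫ y : E n, f ‖y‖ = 1) : 0 < kernelConst d f := by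
  rw [← integral_comp_norm (F := E d) hd (by simp) hs]
  have hne : ∃ t, f t ≠ 0 := by
    by_contra! h
    simp [h] at hi
  obtain ⟨t, ht⟩ := hne
  have : Nontrivial (E d) := Module.nontrivial_of_finrank_pos (R := ℝ) (by
    rw [finrank_euclideanSpace_fin]; omega)
  obtain ⟨u, hu⟩ := exists_norm_eq (E d) (abs_nonneg t)
  refine Continuous.integral_pos_of_hasCompactSupport_nonneg_nonzero (x := u) (by fun_prop)
    (hasCompactSupport_comp_norm fun w hw => hs _ hw) (fun w => hf0 _) ?_
  rw [hu]
  rcases abs_choice t with h | h <;> rw [h]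
  · exact ht
  · rwa [he]

/-- Integration by parts of ⟨a, u⟩ against the derivative of ρ(|u|) in direction b. -/
lemma integral_inner_mul_inner_radialGrad (hρ : Differentiable ℝ ρ) (h0 : deriv ρ 0 = 0)
    {K : ℝ≥0} (hK : LipschitzWith K (deriv ρ)) (hs : tsupport ρ ⊆ Icc (-1) 1) (a b : F) :
    ∫ u : F, inner ℝ a u * inner ℝ b (radialGrad ρ u) = -(inner ℝ a b * ∫ u : F, ρ ‖u‖) := by
  have hG : Continuous (radialGrad ρ : F → F) :=
    (LipschitzWith.of_dist_le_mul (K := 3 * K) fun u v => by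
      simpa [dist_eq_norm] using radialGrad_sub_le hK h0 u v).continuous
  have hG0 : ∀ w : F, 1 ≤ ‖w‖ → radialGrad ρ w = 0 := fun w hw => by
    simp [radialGrad, eq_zero_of_tsupport hK.continuous (tsupport_deriv_subset_Icc hs) hw]
  have hρ0 : ∀ w : F, 1 ≤ ‖w‖ → ρ ‖w‖ = 0 := fun w hw => eq_zero_of_tsupport hρ.continuous hs hw
  have e2 : ∀ u : F, fderiv ℝ (fun u : F => ρ ‖u‖) u b = inner ℝ b (radialGrad ρ u) := fun u => by
    rw [(hasFDerivAt_comp_norm hρ h0 u).fderiv, innerSL_apply_apply, real_inner_comm]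
  have e1 : ∀ u : F, fderiv ℝ (fun u : F => inner ℝ a u) u b = inner ℝ a b := fun u => by
    have : HasFDerivAt (fun u : F => inner ℝ a u) (innerSL ℝ a) u := (innerSL ℝ a).hasFDerivAt
    rw [this.fderiv, innerSL_apply_apply]
  have hρc : Continuous fun u : F => ρ ‖u‖ := hρ.continuous.comp continuous_norm
  have key := integral_mul_fderiv_eq_neg_fderiv_mul_of_integrable (μ := (volume : Measure F))
    (f := fun u : F => inner ℝ a u) (g := fun u : F => ρ ‖u‖) (v := b) ?_ ?_ ?_
    (fun u _ => (innerSL ℝ a).differentiableAt)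
    (fun u _ => (hasFDerivAt_comp_norm hρ h0 u).differentiableAt)
  · simp only [e1, e2] at key
    rw [key, integral_const_mul]
  · simp only [e1]
    exact (hρc.const_mul _ : Continuous fun u : F => inner ℝ a b * ρ ‖u‖).integrable_of_hasCompactSupport
      (hasCompactSupport_comp_norm fun w hw => by simp [hρ0 w hw])
  · simp only [e2]
    exact (by fun_prop : Continuous fun u : F => inner ℝ a u * inner ℝ b (radialGrad ρ u))
      |>.integrable_of_hasCompactSupport
      (hasCompactSupport_comp_norm fun w hw => by simp [hG0 w hw])
  · exact ((continuous_const.inner continuous_id).mul hρc : Continuous fun u : F => inner ℝ a u * ρ ‖u‖)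
      |>.integrable_of_hasCompactSupport
      (hasCompactSupport_comp_norm fun w hw => by simp [hρ0 w hw])

end Kernels

/-! ### Charts of the submanifold and Hausdorff measure of bi-Lipschitz images -/

section Geometry

variable {d n : ℕ} {M : Set (E n)} {x : E n}

/-- Locally M is the zero set of a continuous map, hence relatively closed in an open set; so M is
locally closed. -/
lemma IsC2Submanifold.measurableSet (hM : IsC2Submanifold d M) : MeasurableSet M := by
  have h : IsLocallyClosed M := by
    refine ((isLocallyClosed_tfae M).out 0 3).mpr fun p hp => ?_
    obtain ⟨U, hU, hpU, f, hf, -, hMU⟩ := hM p hp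
    refine ⟨U, hpU, hU, fun y hy => ?_⟩
    have hyc : y ∈ closure (U ∩ M) := hU.inter_closure hy
    have hfc : ContinuousAt f y := hf.continuousOn.continuousAt (hU.mem_nhds hy.1)
    have h0 : f y ∈ closure ({0} : Set (E (n - d))) := by
      refine closure_mono ?_ (hfc.continuousWithinAt.mem_closure_image hyc)
      rintro _ ⟨w, hw, rfl⟩
      exact (hMU.subset ⟨hw.2, hw.1⟩).2
    rw [closure_singleton] at h0
    exact (hMU.superset ⟨hy.1, h0⟩).1
  obtain ⟨U, Z, hU, hZ, rfl⟩ := h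
  exact hU.measurableSet.inter hZ.measurableSet

/-- A `C²` submanifold is parametrized near each of its points by a map from `ℝ^d` whose strict
derivative at the origin is an isometry onto the tangent space. -/
theorem IsC2Submanifold.exists_parametrization (hdn : d ≤ n) (hM : IsC2Submanifold d M)
    (hx : x ∈ M) :
    ∃ (ι : E d →ₗᵢ[ℝ] E n) (ψ : E d → E n), ι.toLinearMap.range = tangentSpace M x ∧ ψ 0 = x ∧
      HasStrictFDerivAt ψ ι.toContinuousLinearMap 0 ∧ (∀ᶠ w in 𝓝 0, ψ w ∈ M) ∧
      ∀ s ∈ 𝓝 (0 : E d), ∀ᶠ y in 𝓝 x, y ∈ M → y ∈ ψ '' s := by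
  obtain ⟨U, hU, hxU, f, hf, hsurj, hMU⟩ := hM x hx
  have hfx : f x = 0 := (hMU.subset ⟨hx, hxU⟩).2
  have hstrict : HasStrictFDerivAt f (fderiv ℝ f x) x :=
    (hf.contDiffAt (hU.mem_nhds hxU)).hasStrictFDerivAt (by norm_num)
  set f' := fderiv ℝ f x with hf'
  have hr : f'.range = ⊤ := LinearMap.range_eq_top.2 (hsurj x hxU)
  have hker : Module.finrank ℝ f'.ker = d := by
    have := LinearMap.finrank_range_add_finrank_ker (f' : E n →ₗ[ℝ] E (n - d))
    rw [hr, finrank_top, finrank_euclideanSpace_fin, finrank_euclideanSpace_fin] at this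
    omega
  let e : f'.ker ≃ₗᵢ[ℝ] E d := ((stdOrthonormalBasis ℝ f'.ker).reindex (finCongr hker)).repr
  -- The implicit function of f has as derivative at 0 the inclusion of ker f'; orthonormal
  -- coordinates on the kernel make the derivative an isometry.
  let ι : E d →ₗᵢ[ℝ] E n := f'.ker.subtypeₗᵢ.comp e.symm.toLinearIsometry
  let ψ₀ := hstrict.implicitFunction f f' hr (f x)
  let ψ : E d → E n := fun w => ψ₀ (e.symm w)
  have hψ0 : ψ 0 = x := by simp [ψ, ψ₀]
  have hψd : HasStrictFDerivAt ψ ι.toContinuousLinearMap 0 := by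
    have h1 : HasStrictFDerivAt ψ₀ f'.ker.subtypeL (e.symm 0) := by
      rw [map_zero]
      exact hstrict.to_implicitFunction hr
    exact h1.comp (0 : E d) (e.symm.toContinuousLinearEquiv.hasStrictFDerivAt)
  have hψt : Tendsto ψ (𝓝 0) (𝓝 x) := by
    have := hψd.hasFDerivAt.continuousAt.tendsto
    rwa [hψ0] at this
  have hψM : ∀ᶠ w in 𝓝 0, ψ w ∈ M := by
    have h1 : Tendsto (fun w : E d => (f x, e.symm w)) (𝓝 0) (𝓝 (f x, 0)) := by
      have : Continuous fun w : E d => (f x, e.symm w) := by fun_prop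
      simpa using this.tendsto 0
    filter_upwards [h1.eventually (hstrict.map_implicitFunction_eq hr),
      hψt.eventually (hU.mem_nhds hxU)] with w hw hwU
    exact (hMU.superset ⟨hwU, hw.trans hfx⟩).1
  refine ⟨ι, ψ, ?_, hψ0, hψd, hψM, fun s hs => ?_⟩
  · have hrange : ι.toLinearMap.range = f'.ker := by
      ext v
      constructor
      · rintro ⟨w, rfl⟩
        exact (e.symm w).2
      · intro hv
        exact ⟨e ⟨v, hv⟩, by simp [ι]⟩
    -- Vectors of ker f' are velocities of t ↦ ψ(tw). Conversely, f vanishes along a curve in M near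
    -- x, so its velocity is in ker f'.
    apply le_antisymm
    · rintro _ ⟨w, rfl⟩
      refine Submodule.subset_span ⟨fun t => ψ (t • w), by simp [hψ0], ?_, ?_⟩
      · have : Tendsto (fun t : ℝ => t • w) (𝓝 0) (𝓝 0) := by
          have : Continuous fun t : ℝ => t • w := by fun_prop
          simpa using this.tendsto 0
        exact this.eventually hψM
      · have h1 : HasDerivAt (fun t : ℝ => t • w) w 0 := by
          simpa using (hasDerivAt_id (0 : ℝ)).smul_const w
        have h2 : HasFDerivAt ψ ι.toContinuousLinearMap ((0 : ℝ) • w) := by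
          simpa using hψd.hasFDerivAt
        exact h2.comp_hasDerivAt (0 : ℝ) h1
    · rw [hrange, tangentSpace, Submodule.span_le]
      rintro v ⟨γ, hγ0, hγM, hγ⟩
      have h1 : HasDerivAt (f ∘ γ) (f' v) 0 := by
        have : HasFDerivAt f f' (γ 0) := by simpa [hγ0] using hstrict.hasFDerivAt
        exact this.comp_hasDerivAt 0 hγ
      have hγU : ∀ᶠ t in 𝓝 0, γ t ∈ U := by
        have := hγ.continuousAt.tendsto
        rw [hγ0] at this
        exact this.eventually (hU.mem_nhds hxU)
      have h2 : HasDerivAt (f ∘ γ) 0 0 := by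
        refine (hasDerivAt_const (0 : ℝ) (0 : E (n - d))).congr_of_eventuallyEq ?_
        filter_upwards [hγM, hγU] with t ht htU
        exact (hMU.subset ⟨ht, htU⟩).2
      exact h1.unique h2
  -- The kernel coordinate of y: a point of M near x has f y = f x and is recovered as ψ (g y).
  · let g : E n → E d := fun y => e (hstrict.implicitToOpenPartialHomeomorph f f' hr y).2
    have hg : Tendsto g (𝓝 x) (𝓝 0) := by
      have h1 := (hstrict.implicitToOpenPartialHomeomorph f f' hr).continuousAt
        (hstrict.mem_implicitToOpenPartialHomeomorph_source hr)
      have h2 : ContinuousAt g x := e.continuous.continuousAt.comp h1.snd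
      have h3 : g x = 0 := by simp [g]
      simpa [ContinuousAt, h3] using h2
    filter_upwards [hg.eventually hs, hstrict.eq_implicitFunction hr, hU.mem_nhds hxU]
      with y hys hy hyU hyM
    refine ⟨g y, hys, ?_⟩
    have : f y = f x := by rw [hfx]; exact (hMU.subset ⟨hyM, hyU⟩).2
    simp only [ψ, ψ₀, g, LinearIsometryEquiv.symm_apply_apply, ← this]
    exact hy

lemma euclideanHausdorffMeasure_image_le {X Y : Type*} [EMetricSpace X] [MeasurableSpace X]
    [BorelSpace X] [EMetricSpace Y] [MeasurableSpace Y] [BorelSpace Y] {K : ℝ≥0} {f : X → Y}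
    {s : Set X} (h : LipschitzOnWith K f s) (d : ℕ) :
    (μHE[d] : Measure Y) (f '' s) ≤ (K : ℝ≥0∞) ^ d * (μHE[d] : Measure X) s := by
  rw [Measure.euclideanHausdorffMeasure_def, Measure.euclideanHausdorffMeasure_def,
    Measure.smul_apply, Measure.smul_apply]
  have := h.hausdorffMeasure_image_le (d := d) (Nat.cast_nonneg d)
  rw [ENNReal.rpow_natCast] at this
  simp only [ENNReal.smul_def, smul_eq_mul]
  rw [mul_left_comm]
  gcongr

lemma restrict_image_le_map {ψ : E d → E n} {s : Set (E d)} (hs : MeasurableSet s) {K : ℝ≥0}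
    (hψ : LipschitzOnWith K ψ s) :
    (μHE[d] : Measure (E n)).restrict (ψ '' s) ≤
      (K : ℝ≥0∞) ^ d • (volume.restrict s).map ψ := by
  have hm : AEMeasurable ψ (volume.restrict s) := hψ.continuousOn.aemeasurable hs
  refine Measure.le_iff.2 fun A hA => ?_
  rw [Measure.restrict_apply hA, Measure.smul_apply, Measure.map_apply_of_aemeasurable hm hA,
    Measure.restrict_apply' hs, ← EuclideanSpace.euclideanHausdorffMeasure_eq_volume,
    ← image_preimage_inter]
  exact euclideanHausdorffMeasure_image_le (hψ.mono inter_subset_right) d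

/-- The lower distance bound says that ψ is injective on s with K-Lipschitz inverse; the Lipschitz
estimate for Hausdorff measure is applied to that inverse. -/
lemma map_le_restrict_image {ψ : E d → E n} {s : Set (E d)} (hs : MeasurableSet s) {K : ℝ≥0}
    (hψc : ContinuousOn ψ s) (hψ : ∀ u ∈ s, ∀ v ∈ s, dist u v ≤ K * dist (ψ u) (ψ v)) :
    (volume.restrict s).map ψ ≤
      (K : ℝ≥0∞) ^ d • (μHE[d] : Measure (E n)).restrict (ψ '' s) := by
  have hm : AEMeasurable ψ (volume.restrict s) := hψc.aemeasurable hs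
  have hinj : InjOn ψ s := fun u hu v hv h => by
    have := hψ u hu v hv
    rw [h, dist_self, mul_zero] at this
    exact dist_le_zero.1 this
  let g := Function.invFunOn ψ s
  have hgl : ∀ u ∈ s, g (ψ u) = u := fun u hu => hinj.leftInvOn_invFunOn hu
  have hg : LipschitzOnWith K g (ψ '' s) := by
    refine LipschitzOnWith.of_dist_le_mul ?_
    rintro _ ⟨u, hu, rfl⟩ _ ⟨v, hv, rfl⟩
    rw [hgl u hu, hgl v hv]
    exact hψ u hu v hv
  refine Measure.le_iff.2 fun A hA => ?_
  rw [Measure.smul_apply, Measure.restrict_apply hA, Measure.map_apply_of_aemeasurable hm hA,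
    Measure.restrict_apply' hs, ← EuclideanSpace.euclideanHausdorffMeasure_eq_volume,
    ← image_preimage_inter]
  have e : ψ ⁻¹' A ∩ s = g '' (ψ '' (ψ ⁻¹' A ∩ s)) := by
    rw [← image_comp]
    conv_lhs => rw [← image_id (ψ ⁻¹' A ∩ s)]
    exact image_congr fun u hu => (hgl u hu.2).symm
  conv_lhs => rw [e]
  exact euclideanHausdorffMeasure_image_le (hg.mono (image_mono inter_subset_right)) d

lemma exists_ball_bilipschitz {ι : E d →ₗᵢ[ℝ] E n} {ψ : E d → E n}
    (hψ : HasStrictFDerivAt ψ ι.toContinuousLinearMap 0) {K : ℝ≥0} (hK : 1 < K) :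
    ∃ s ∈ 𝓝 (0 : E d), LipschitzOnWith K ψ s ∧
      ∀ u ∈ s, ∀ v ∈ s, dist u v ≤ K * dist (ψ u) (ψ v) := by
  have hK0 : (0 : ℝ) < K := by exact_mod_cast zero_lt_one.trans hK
  have hK1 : (1 : ℝ) < K := by exact_mod_cast hK
  -- Deviating from the isometry by at most c|u - v| gives the factors 1 + c and 1 - c; this c
  -- satisfies 1 + c ≤ K and 1 - c = 1/K.
  obtain ⟨c, hc⟩ : ∃ c : ℝ≥0, (c : ℝ) = 1 - (K : ℝ)⁻¹ :=
    ⟨⟨1 - (K : ℝ)⁻¹, sub_nonneg.2 (inv_le_one_of_one_le₀ hK1.le)⟩, rfl⟩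
  have hc0 : 0 < c := by
    rw [← NNReal.coe_pos, hc, sub_pos]
    exact inv_lt_one_of_one_lt₀ hK1
  obtain ⟨s, hs, happ⟩ := hψ.approximates_deriv_on_nhds (Or.inr hc0)
  have key : ∀ u ∈ s, ∀ v ∈ s, ‖ψ u - ψ v - ι (u - v)‖ ≤ c * ‖u - v‖ := happ
  refine ⟨s, hs, LipschitzOnWith.of_dist_le_mul fun u hu v hv => ?_, fun u hu v hv => ?_⟩
  · rw [dist_eq_norm, dist_eq_norm]
    have h1 := key u hu v hv
    have h2 := norm_le_norm_add_norm_sub' (ψ u - ψ v) (ι (u - v))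
    rw [ι.norm_map] at h2
    have h3 : 1 + (c : ℝ) ≤ K := by
      rw [hc]
      have : (K : ℝ) * (K : ℝ)⁻¹ = 1 := mul_inv_cancel₀ hK0.ne'
      nlinarith [inv_pos.2 hK0]
    nlinarith [norm_nonneg (u - v)]
  · rw [dist_eq_norm, dist_eq_norm]
    have h1 := key u hu v hv
    have h2 := norm_le_norm_add_norm_sub' (ι (u - v)) (ψ u - ψ v)
    rw [ι.norm_map, norm_sub_rev (ι (u - v))] at h2
    have h3 : (K : ℝ)⁻¹ * ‖u - v‖ ≤ ‖ψ u - ψ v‖ := by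
      have : (K : ℝ)⁻¹ = 1 - c := by rw [hc]; ring
      rw [this]
      linarith
    rwa [inv_mul_le_iff₀ hK0] at h3

end Geometry

/-! ### Blow-up of Hausdorff measure through a chart -/

section BlowUp

variable {d n : ℕ} {M : Set (E n)} {x : E n}

/-- After the substitution w = εu the argument of φ is the difference quotient of ψ at 0, which
tends to ιu. The lower bound on |ψ w - x| confines the integrands to the ball of radius KR, so
dominated convergence applies. -/
lemma tendsto_integral_parametrization {ι : E d →ₗᵢ[ℝ] E n} {ψ : E d → E n} (h0 : ψ 0 = x)
    (hψ : HasFDerivAt ψ ι.toContinuousLinearMap 0) {s : Set (E d)} (hs : s ∈ 𝓝 (0 : E d))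
    (hsm : MeasurableSet s) (hψc : ContinuousOn ψ s) {K : ℝ} (hK : 0 ≤ K)
    (hψK : ∀ u ∈ s, ‖u‖ ≤ K * ‖ψ u - x‖) {φ : E n → ℝ} (hφ : Continuous φ) {R : ℝ}
    (hφR : ∀ w, R ≤ ‖w‖ → φ w = 0) :
    Tendsto (fun ε : ℝ => (ε ^ d)⁻¹ * ∫ w in s, φ (ε⁻¹ • (ψ w - x))) (𝓝[>] 0)
      (𝓝 (∫ u, φ (ι u))) := by
  have hcs : HasCompactSupport φ :=
    HasCompactSupport.intro (isCompact_closedBall (0 : E n) R) fun w hw => hφR w (by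
      rw [mem_closedBall_zero_iff, not_le] at hw
      exact hw.le)
  obtain ⟨B, hB⟩ := hcs.exists_bound_of_continuous hφ
  have hB0 : 0 ≤ B := (norm_nonneg _).trans (hB 0)
  let h : ℝ → E d → ℝ := fun ε u =>
    ((fun u : E d => ε • u) ⁻¹' s).indicator (fun u => φ (ε⁻¹ • (ψ (ε • u) - x))) u
  have e1 : ∀ ε : ℝ, 0 < ε → ∫ u, h ε u = (ε ^ d)⁻¹ * ∫ w in s, φ (ε⁻¹ • (ψ w - x)) := by
    intro ε hε
    rw [← integral_indicator hsm]
    have := Measure.integral_comp_smul_of_nonneg (volume : Measure (E d))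
      (s.indicator fun w => φ (ε⁻¹ • (ψ w - x))) ε (hR := hε.le)
    rw [finrank_euclideanSpace_fin, smul_eq_mul] at this
    rw [← this]
    rfl
  have hlim : Tendsto (fun ε : ℝ => ∫ u, h ε u) (𝓝[>] 0) (𝓝 (∫ u, φ (ι u))) := by
    refine tendsto_integral_filter_of_dominated_convergence
      ((Metric.closedBall (0 : E d) (K * R)).indicator fun _ => B) ?_ ?_ ?_ ?_
    · filter_upwards [self_mem_nhdsWithin] with ε hε
      have hms : MeasurableSet ((fun u : E d => ε • u) ⁻¹' s) :=
        (measurable_const_smul ε) hsm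
      refine (aestronglyMeasurable_indicator_iff hms).2
        (ContinuousOn.aestronglyMeasurable ?_ hms)
      have h1 : ContinuousOn (fun u : E d => ψ (ε • u)) ((fun u : E d => ε • u) ⁻¹' s) :=
        hψc.comp (by fun_prop) fun u hu => hu
      exact hφ.comp_continuousOn ((h1.sub continuousOn_const).const_smul ε⁻¹)
    · filter_upwards [self_mem_nhdsWithin] with ε hε
      have hε' : 0 < ε := hε
      refine Eventually.of_forall fun u => ?_
      by_cases hu : u ∈ Metric.closedBall (0 : E d) (K * R)
      · rw [indicator_of_mem hu]
        refine (norm_indicator_le_norm_self _ _).trans (hB _)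
      · rw [indicator_of_notMem hu, norm_le_zero_iff]
        refine indicator_apply_eq_zero.2 fun hus => hφR _ ?_
        rw [mem_closedBall_zero_iff, not_le] at hu
        have h1 := hψK _ hus
        rw [norm_smul, Real.norm_eq_abs, abs_of_pos hε'] at h1
        rw [norm_smul, norm_inv, Real.norm_eq_abs, abs_of_pos hε']
        have h2 : K * R < K * (ε⁻¹ * ‖ψ (ε • u) - x‖) := by
          refine hu.trans_le ?_
          rw [mul_left_comm, le_inv_mul_iff₀ hε']
          exact h1
        exact (lt_of_mul_lt_mul_left h2 hK).le
    · exact (integrable_indicator_iff measurableSet_closedBall).2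
        (integrableOn_const (measure_closedBall_lt_top.ne))
    · refine Eventually.of_forall fun u => ?_
      have hev : ∀ᶠ ε : ℝ in 𝓝[>] 0, ε • u ∈ s := by
        have : Tendsto (fun ε : ℝ => ε • u) (𝓝[>] 0) (𝓝 0) := by
          have : Continuous fun ε : ℝ => ε • u := by fun_prop
          simpa using (this.tendsto 0).mono_left nhdsWithin_le_nhds
        exact this.eventually hs
      have hd : HasDerivAt (fun ε : ℝ => ψ (ε • u)) (ι u) 0 := by
        have h1 : HasDerivAt (fun t : ℝ => t • u) u 0 := by
          simpa using (hasDerivAt_id (0 : ℝ)).smul_const u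
        have h2 : HasFDerivAt ψ ι.toContinuousLinearMap ((0 : ℝ) • u) := by simpa using hψ
        exact h2.comp_hasDerivAt (0 : ℝ) h1
      have hsl := hd.tendsto_slope_zero_right
      simp only [zero_add, zero_smul, h0] at hsl
      refine ((hφ.tendsto _).comp hsl).congr' ?_
      filter_upwards [hev] with ε hε
      exact (indicator_of_mem (s := (fun u : E d => ε • u) ⁻¹' s) hε
        (fun u => φ (ε⁻¹ • (ψ (ε • u) - x)))).symm
  refine hlim.congr' ?_
  filter_upwards [self_mem_nhdsWithin] with ε hε using e1 ε hε

lemma exists_one_lt_pow_mul_lt {a b : ℝ} (h : a < b) (d : ℕ) :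
    ∃ K : ℝ≥0, 1 < K ∧ (K : ℝ) ^ d * a < b := by
  have hc : Continuous fun k : ℝ => k ^ d * a := by fun_prop
  have ht : Tendsto (fun k : ℝ => k ^ d * a) (𝓝[>] 1) (𝓝 a) := by
    simpa using (hc.tendsto 1).mono_left nhdsWithin_le_nhds
  obtain ⟨k, hk, hk1⟩ := ((ht.eventually_lt_const h).and self_mem_nhdsWithin).exists
  have hk1' : (1 : ℝ) < k := hk1
  exact ⟨⟨k, by linarith⟩, hk1', hk⟩

/-- For each K > 1 a small chart compares the integral over M with the one over the parameter domain
up to K^d on both sides. The latter converges to the same limit for every K, and letting K tend to 1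
closes the gap. Nonnegativity of φ is what lets the comparison of measures pass to integrals. -/
lemma blowUp_of_nonneg (hM : IsC2Submanifold d M) {ι : E d →ₗᵢ[ℝ] E n}
    {ψ : E d → E n} (h0 : ψ 0 = x)
    (hψ : HasStrictFDerivAt ψ ι.toContinuousLinearMap 0) (hψM : ∀ᶠ w in 𝓝 0, ψ w ∈ M)
    (hMψ : ∀ s ∈ 𝓝 (0 : E d), ∀ᶠ y in 𝓝 x, y ∈ M → y ∈ ψ '' s)
    {φ : E n → ℝ} (hφ : Continuous φ) {R : ℝ} (hφR : ∀ w, R ≤ ‖w‖ → φ w = 0)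
    (hφ0 : ∀ w, 0 ≤ φ w) :
    Tendsto (fun ε : ℝ => (ε ^ d)⁻¹ * ∫ y in M, φ (ε⁻¹ • (y - x)) ∂μHE[d]) (𝓝[>] 0)
      (𝓝 (∫ u, φ (ι u))) := by
  have key : ∀ K : ℝ≥0, 1 < K → ∃ I : ℝ → ℝ, Tendsto I (𝓝[>] 0) (𝓝 (∫ u, φ (ι u))) ∧
      ∀ᶠ ε in 𝓝[>] 0,
        (ε ^ d)⁻¹ * ∫ y in M, φ (ε⁻¹ • (y - x)) ∂μHE[d] ≤ (K : ℝ) ^ d * I ε ∧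
        I ε ≤ (K : ℝ) ^ d * ((ε ^ d)⁻¹ * ∫ y in M, φ (ε⁻¹ • (y - x)) ∂μHE[d]) := by
    intro K hK
    obtain ⟨s₀, hs₀, hl₀, ha₀⟩ := exists_ball_bilipschitz hψ hK
    obtain ⟨r, hr, hrs⟩ := Metric.mem_nhds_iff.1 (Filter.inter_mem hs₀ hψM)
    set s := Metric.ball (0 : E d) r with hsdef
    have hsn : s ∈ 𝓝 (0 : E d) := Metric.ball_mem_nhds _ hr
    have hsm : MeasurableSet s := Metric.isOpen_ball.measurableSet
    have hl : LipschitzOnWith K ψ s := hl₀.mono fun u hu => (hrs hu).1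
    have ha : ∀ u ∈ s, ∀ v ∈ s, dist u v ≤ K * dist (ψ u) (ψ v) :=
      fun u hu v hv => ha₀ u (hrs hu).1 v (hrs hv).1
    have hsM : ψ '' s ⊆ M := by
      rintro _ ⟨u, hu, rfl⟩
      exact (hrs hu).2
    refine ⟨fun ε : ℝ => (ε ^ d)⁻¹ * ∫ w in s, φ (ε⁻¹ • (ψ w - x)),
      tendsto_integral_parametrization h0 hψ.hasFDerivAt hsn hsm hl.continuousOn K.2
        (fun u hu => by
          have := ha u hu 0 (mem_of_mem_nhds hsn)
          rwa [dist_eq_norm, dist_eq_norm, sub_zero, h0] at this) hφ hφR, ?_⟩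
    obtain ⟨t, ht, hts⟩ := Metric.eventually_nhds_iff_ball.1 (hMψ s hsn)
    have hsmall : ∀ᶠ ε : ℝ in 𝓝[>] 0, ε * R < t := by
      have hc : Continuous fun ε : ℝ => ε * R := by fun_prop
      have : Tendsto (fun ε : ℝ => ε * R) (𝓝[>] 0) (𝓝 0) := by
        simpa using (hc.tendsto 0).mono_left nhdsWithin_le_nhds
      exact this.eventually_lt_const ht
    filter_upwards [self_mem_nhdsWithin, hsmall] with ε hε hεt
    have hε' : 0 < ε := hε
    let g : E n → ℝ := fun y => φ (ε⁻¹ • (y - x))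
    have hgc : Continuous g := by fun_prop
    have hg0 : ∀ y, 0 ≤ g y := fun y => hφ0 _
    have hcs : HasCompactSupport g :=
      HasCompactSupport.intro (isCompact_closedBall x (ε * R)) fun y hy => hφR _ (by
        rw [mem_closedBall_iff_norm, not_le] at hy
        rw [norm_smul, norm_inv, Real.norm_eq_abs, abs_of_pos hε', le_inv_mul_iff₀ hε']
        exact hy.le)
    -- For small ε the support of g lies so close to x that M has no points there outside the chart.
    have e1 : ∫ y in M, g y ∂μHE[d] = ∫ y in ψ '' s, g y ∂μHE[d] := by
      refine setIntegral_eq_of_subset_of_forall_sdiff_eq_zero hM.measurableSet hsM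
        fun y hy => hφR _ ?_
      rw [norm_smul, norm_inv, Real.norm_eq_abs, abs_of_pos hε', le_inv_mul_iff₀ hε']
      by_contra! hlt
      exact hy.2 (hts y (mem_ball_iff_norm.2 (hlt.trans hεt)) hy.1)
    have hm : AEMeasurable ψ (volume.restrict s) := hl.continuousOn.aemeasurable hsm
    have e2 : ∫ y, g y ∂(volume.restrict s).map ψ = ∫ w in s, g (ψ w) :=
      integral_map hm hgc.aestronglyMeasurable
    have : IsFiniteMeasure (volume.restrict s) :=
      ⟨by rw [Measure.restrict_apply_univ]; exact measure_ball_lt_top⟩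
    have hKtop : (K : ℝ≥0∞) ^ d ≠ ∞ := ENNReal.pow_ne_top ENNReal.coe_ne_top
    have hle1 := restrict_image_le_map (n := n) hsm hl
    have hle2 := map_le_restrict_image (n := n) hsm hl.continuousOn ha
    have hi1 : Integrable g ((volume.restrict s).map ψ) :=
      hgc.integrable_of_hasCompactSupport hcs
    have hi1' := hi1.smul_measure hKtop
    have hi2 : Integrable g ((μHE[d] : Measure (E n)).restrict (ψ '' s)) :=
      hi1'.mono_measure hle1
    have hi2' := hi2.smul_measure hKtop
    have q1 := integral_mono_measure hle1 (Eventually.of_forall hg0) hi1'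
    have q2 := integral_mono_measure hle2 (Eventually.of_forall hg0) hi2'
    rw [integral_smul_measure, e2, ENNReal.toReal_pow, ENNReal.coe_toReal, smul_eq_mul] at q1
    rw [integral_smul_measure, e2, ENNReal.toReal_pow, ENNReal.coe_toReal, smul_eq_mul] at q2
    have hεd : 0 ≤ (ε ^ d)⁻¹ := by positivity
    change (ε ^ d)⁻¹ * ∫ y in M, g y ∂μHE[d] ≤ _ ∧
      _ ≤ (K : ℝ) ^ d * ((ε ^ d)⁻¹ * ∫ y in M, g y ∂μHE[d])
    rw [e1, mul_left_comm, mul_left_comm ((K : ℝ) ^ d)]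
    exact ⟨mul_le_mul_of_nonneg_left q1 hεd, mul_le_mul_of_nonneg_left q2 hεd⟩
  refine tendsto_order.2 ⟨fun a ha => ?_, fun b hb => ?_⟩
  · obtain ⟨K, hK, hKa⟩ := exists_one_lt_pow_mul_lt ha d
    obtain ⟨I, hI, hev⟩ := key K hK
    filter_upwards [hev, hI.eventually_const_lt hKa] with ε h1 h2
    exact lt_of_mul_lt_mul_left (h2.trans_le h1.2) (by positivity)
  · obtain ⟨K, hK, hKa⟩ := exists_one_lt_pow_mul_lt hb d
    obtain ⟨I, hI, hev⟩ := key K hK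
    filter_upwards [hev, (hI.const_mul ((K : ℝ) ^ d)).eventually_lt_const hKa] with ε h1 h2
    exact h1.1.trans_lt h2

end BlowUp

/-! ### Mass measures and weak convergence of their rescalings -/

section Mass

variable {d n : ℕ} {Ω : Set (E n)} (V : Varifold d n Ω)

lemma Varifold.mass_apply {A : Set (E n)} (hA : MeasurableSet A) :
    V.mass A = V.measure (A ×ˢ univ) := by
  rw [Varifold.mass, Measure.map_apply measurable_fst hA, prod_univ]

lemma Varifold.mass_compl (hΩ : IsOpen Ω) : V.mass Ωᶜ = 0 := by
  rw [V.mass_apply hΩ.measurableSet.compl]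
  exact measure_mono_null (fun p hp (h : p ∈ Ω ×ˢ Gr d n) => hp.1 h.1) V.carried

lemma Varifold.ae_mem (hΩ : IsOpen Ω) : ∀ᵐ y ∂V.mass, y ∈ Ω := V.mass_compl hΩ

lemma Varifold.ae_mem_supp (hΩ : IsOpen Ω) : ∀ᵐ y ∂V.mass, y ∈ V.supp := by
  filter_upwards [V.ae_mem hΩ, Measure.support_mem_ae (μ := V.mass)] with y h1 h2 using ⟨h2, h1⟩

lemma Varifold.ae_mem_Gr : ∀ᵐ p ∂V.measure, p.2 ∈ Gr d n :=
  measure_mono_null (fun p hp (h : p ∈ Ω ×ˢ Gr d n) => hp h.2) V.carried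

lemma Varifold.setIntegral_mass (hΩ : IsOpen Ω) {G : Type*} [NormedAddCommGroup G]
    [NormedSpace ℝ G] (g : E n → G) : ∫ y in Ω, g y ∂V.mass = ∫ y, g y ∂V.mass := by
  rw [Measure.restrict_eq_self_of_ae_mem (V.ae_mem hΩ)]

lemma Varifold.mass_lt_top_of_isCompact {K : Set (E n)} (hK : IsCompact K) (hKΩ : K ⊆ Ω) :
    V.mass K < ∞ := by
  rw [V.mass_apply hK.measurableSet]
  refine lt_of_le_of_lt ?_ (V.finite_on_compacts K hK hKΩ)
  refine measure_mono_ae ?_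
  filter_upwards [V.ae_mem_Gr] with p hp hpK using ⟨hpK.1, hp⟩

lemma Varifold.integrable_mass {G : Type*} [NormedAddCommGroup G]
    [SecondCountableTopology G] {K : Set (E n)} (hK : IsCompact K)
    (hKΩ : K ⊆ Ω) {g : E n → G} (hg : Continuous g) (hgK : ∀ y, y ∉ K → g y = 0) :
    Integrable g V.mass := by
  obtain ⟨B, hB⟩ := (HasCompactSupport.intro hK hgK).exists_bound_of_continuous hg
  refine (integrableOn_iff_integrable_of_support_subset (s := K) ?_).1 ?_
  · intro y hy
    by_contra h
    exact hy (hgK y h)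
  · exact Measure.integrableOn_of_bounded (M := B) (V.mass_lt_top_of_isCompact hK hKΩ).ne
      hg.aestronglyMeasurable (Eventually.of_forall hB)

variable {V} {M : Set (E n)} {x : E n}

/-- Measurability is borrowed from the continuous extension T, which equals the tangent projection
on M. It is what makes the pushforward defining v(M, 1) meaningful. -/
lemma IsUnitDensityVarifold.aemeasurable_tangentProj {N : Set (E n)} (hMN : M ⊆ N)
    {T : E n → (E n →L[ℝ] E n)} (hT : ContinuousOn T N) (hTM : ∀ y ∈ M, T y = tangentProj M y)
    (hM : MeasurableSet M) (μ : Measure (E n)) :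
    AEMeasurable (fun y => (y, tangentProj M y)) (μ.restrict M) := by
  refine aemeasurable_id.prodMk ?_
  refine ((hT.mono hMN).aemeasurable hM).congr ?_
  filter_upwards [ae_restrict_mem hM] with y hy using hTM y hy

lemma IsUnitDensityVarifold.mass_eq (hV : IsUnitDensityVarifold V M)
    (hm : AEMeasurable (fun y => (y, tangentProj M y)) ((μHE[d] : Measure (E n)).restrict M)) :
    V.mass = (μHE[d] : Measure (E n)).restrict M := by
  rw [Varifold.mass, hV, AEMeasurable.map_map_of_aemeasurable measurable_fst.aemeasurable hm]
  exact Measure.map_id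

lemma eventually_closedBall_subset (hΩ : IsOpen Ω) (hx : x ∈ Ω) :
    ∀ᶠ r : ℝ in 𝓝[>] 0, Metric.closedBall x r ⊆ Ω := by
  obtain ⟨r, hr, hrΩ⟩ := Metric.nhds_basis_closedBall.mem_iff.1 (hΩ.mem_nhds hx)
  filter_upwards [Ioo_mem_nhdsGT hr] with t ht
  exact (Metric.closedBall_subset_closedBall ht.2.le).trans hrΩ

lemma notMem_closedBall_scaled {G : Type*} [Zero G] {φ : E n → G} (hφ : ∀ w, 1 ≤ ‖w‖ → φ w = 0)
    {ε : ℝ} (hε : 0 < ε) {y : E n} (hy : y ∉ Metric.ball x ε) : φ (ε⁻¹ • (y - x)) = 0 := by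
  refine hφ _ ?_
  rw [mem_ball_iff_norm, not_lt] at hy
  rw [norm_smul, norm_inv, Real.norm_eq_abs, abs_of_pos hε, le_inv_mul_iff₀ hε, mul_one]
  exact hy

lemma Varifold.integrable_scaled (V : Varifold d n Ω) {G : Type*} [NormedAddCommGroup G]
    [SecondCountableTopology G] {φ : E n → G} (hφc : Continuous φ) (hφ : ∀ w, 1 ≤ ‖w‖ → φ w = 0)
    {ε : ℝ} (hε : 0 < ε) (h : Metric.closedBall x ε ⊆ Ω) :
    Integrable (fun y => φ (ε⁻¹ • (y - x))) V.mass :=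
  V.integrable_mass (isCompact_closedBall x ε) h (by fun_prop) fun _ hy =>
    notMem_closedBall_scaled hφ hε fun hy' => hy (Metric.ball_subset_closedBall hy')

/-- Blow-up of a `C²` submanifold at one of its points: the rescalings of the mass converge
weakly to the Hausdorff measure on the tangent space. -/
theorem blowUp (hΩ : IsOpen Ω) (hdn : d ≤ n) (hM : IsC2Submanifold d M) (hMΩ : M ⊆ Ω) (hx : x ∈ M)
    (hV : V.mass = (μHE[d] : Measure (E n)).restrict M) :
    ∃ ι : E d →ₗᵢ[ℝ] E n, ι.toLinearMap.range = tangentSpace M x ∧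
      ∀ φ : E n → ℝ, Continuous φ → (∀ w, 1 ≤ ‖w‖ → φ w = 0) →
      Tendsto (fun ε : ℝ => (ε ^ d)⁻¹ * ∫ y, φ (ε⁻¹ • (y - x)) ∂V.mass) (𝓝[>] 0)
        (𝓝 (∫ u, φ (ι u))) := by
  obtain ⟨ι, ψ, hι, h0, hψ, hψM, hMψ⟩ := hM.exists_parametrization hdn hx
  refine ⟨ι, hι, fun φ hφ hφ0 => ?_⟩
  -- A signed φ is split into positive and negative parts.
  have hp := blowUp_of_nonneg (R := 1) hM h0 hψ hψM hMψ (hφ.max continuous_const)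
    (fun w hw => by simp [hφ0 w hw]) (fun w => le_max_right (φ w) 0)
  have hn := blowUp_of_nonneg (R := 1) (φ := fun w => max (-φ w) 0) hM h0 hψ hψM hMψ (by fun_prop)
    (fun w hw => by simp [hφ0 w hw]) (fun w => le_max_right (-φ w) 0)
  have hsplit : ∀ t : ℝ, max t 0 - max (-t) 0 = t := fun t => by
    rcases le_total 0 t with h | h <;> simp [h]
  have hint : ∀ {χ : E n → ℝ}, Continuous χ → (∀ w, 1 ≤ ‖w‖ → χ w = 0) →
      Integrable (fun u => χ (ι u)) := fun {χ} hχ hχ0 =>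
    (hχ.comp ι.continuous).integrable_of_hasCompactSupport
      (hasCompactSupport_comp_norm fun w hw => hχ0 _ (by rwa [ι.norm_map]))
  have hlim := hp.sub hn
  rw [← integral_sub (hint (hφ.max continuous_const) fun w hw => by simp [hφ0 w hw])
    (hint (χ := fun w => max (-φ w) 0) (by fun_prop) fun w hw => by simp [hφ0 w hw])] at hlim
  simp only [hsplit] at hlim
  refine hlim.congr' ?_
  filter_upwards [self_mem_nhdsWithin, eventually_closedBall_subset hΩ (hMΩ hx)] with ε hε hεΩ
  rw [← hV, ← mul_sub, ← integral_sub
    (V.integrable_scaled (φ := fun w => max (φ w) 0) (by fun_prop)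
      (fun w hw => by simp [hφ0 w hw]) hε hεΩ)
    (V.integrable_scaled (φ := fun w => max (-φ w) 0) (by fun_prop)
      (fun w hw => by simp [hφ0 w hw]) hε hεΩ)]
  simp only [hsplit]

lemma tendsto_of_coord {α : Type*} {l : Filter α} {f : α → E n} {a : E n}
    (h : ∀ j, Tendsto (fun t => f t j) l (𝓝 (a j))) : Tendsto f l (𝓝 a) :=
  ((PiLp.continuous_toLp 2 fun _ : Fin n => ℝ).tendsto _).comp (tendsto_pi_nhds.2 h)

/-- The vector-valued form of weak convergence of rescaled measures follows from the scalar one. -/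
lemma tendsto_blowUp_vector (hΩ : IsOpen Ω) (hx : x ∈ Ω) {ι : E d →ₗᵢ[ℝ] E n}
    (hι : ∀ φ : E n → ℝ, Continuous φ → (∀ w, 1 ≤ ‖w‖ → φ w = 0) →
      Tendsto (fun ε : ℝ => (ε ^ d)⁻¹ * ∫ y, φ (ε⁻¹ • (y - x)) ∂V.mass) (𝓝[>] 0)
        (𝓝 (∫ u, φ (ι u))))
    {φ : E n → E n} (hφ : Continuous φ) (hφ0 : ∀ w, 1 ≤ ‖w‖ → φ w = 0) :
    Tendsto (fun ε : ℝ => (ε ^ d)⁻¹ • ∫ y, φ (ε⁻¹ • (y - x)) ∂V.mass) (𝓝[>] 0)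
      (𝓝 (∫ u, φ (ι u))) := by
  refine tendsto_of_coord fun j => ?_
  have hint : Integrable fun u => φ (ι u) :=
    (hφ.comp ι.continuous).integrable_of_hasCompactSupport
      (hasCompactSupport_comp_norm fun w hw => hφ0 _ (by rwa [ι.norm_map]))
  have h1 := hι (fun w => φ w j) (by fun_prop) fun w hw => by simp [hφ0 w hw]
  have e1 : (∫ u, φ (ι u)) j = ∫ u, φ (ι u) j :=
    ((EuclideanSpace.proj j : E n →L[ℝ] ℝ).integral_comp_comm hint).symm
  rw [e1]
  refine h1.congr' ?_
  filter_upwards [self_mem_nhdsWithin, eventually_closedBall_subset hΩ hx] with ε hε hεΩ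
  have e2 := (EuclideanSpace.proj j : E n →L[ℝ] ℝ).integral_comp_comm
    (V.integrable_scaled hφ hφ0 hε hεΩ)
  rw [PiLp.smul_apply, smul_eq_mul]
  exact congrArg _ e2

end Mass

/-! ### Error estimates when the varifold, the base point or the tangent field changes -/

section Comparison

variable {d n : ℕ} {Ω : Set (E n)} {V W : Varifold d n Ω} {x z : E n}

/-- Dividing g by A makes it admissible in the supremum. The strict inequality s < r keeps the
closed support inside the open ball. -/
lemma abs_integral_sub_le (hΩ : IsOpen Ω) {r s D A : ℝ} (hsr : s < r) (hD : 0 ≤ D)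
    (hΔ : boundedLipschitzDist Ω (Metric.ball x r) V.mass W.mass ≤ ENNReal.ofReal D)
    {g : E n → ℝ} (hA : 0 < A) (hgl : ∀ y y', |g y - g y'| ≤ A * ‖y - y'‖)
    (hgb : ∀ y, |g y| ≤ A) (hgs : ∀ y, y ∉ Metric.closedBall x s → g y = 0) :
    |∫ y, g y ∂V.mass - ∫ y, g y ∂W.mass| ≤ A * D := by
  have hmem : (fun y => A⁻¹ * g y) ∈ {φ : E n → ℝ | LipschitzOnWith 1 φ Ω ∧
      (∀ y ∈ Ω, |φ y| ≤ 1) ∧ closure {y ∈ Ω | φ y ≠ 0} ∩ Ω ⊆ Metric.ball x r} := by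
    refine ⟨LipschitzOnWith.of_dist_le_mul fun y _ y' _ => ?_, fun y _ => ?_, ?_⟩
    · rw [Real.dist_eq, ← mul_sub, abs_mul, abs_of_pos (inv_pos.2 hA), NNReal.coe_one, one_mul,
        dist_eq_norm, inv_mul_le_iff₀ hA]
      exact hgl y y'
    · rw [abs_mul, abs_of_pos (inv_pos.2 hA), inv_mul_le_iff₀ hA, mul_one]
      exact hgb y
    · have h1 : {y ∈ Ω | A⁻¹ * g y ≠ 0} ⊆ Metric.closedBall x s := by
        intro y hy
        by_contra h
        exact hy.2 (by rw [hgs y h, mul_zero])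
      exact inter_subset_left.trans ((closure_minimal h1 Metric.isClosed_closedBall).trans
        (Metric.closedBall_subset_ball hsr))
  have h1 : ENNReal.ofReal |(∫ y in Ω, A⁻¹ * g y ∂V.mass) - ∫ y in Ω, A⁻¹ * g y ∂W.mass| ≤
      ENNReal.ofReal D :=
    (le_iSup₂_of_le (f := fun (φ : E n → ℝ) (_ : φ ∈ {φ : E n → ℝ | LipschitzOnWith 1 φ Ω ∧
      (∀ y ∈ Ω, |φ y| ≤ 1) ∧ closure {y ∈ Ω | φ y ≠ 0} ∩ Ω ⊆ Metric.ball x r}) =>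
        ENNReal.ofReal |(∫ y in Ω, φ y ∂V.mass) - ∫ y in Ω, φ y ∂W.mass|)
      (fun y => A⁻¹ * g y) hmem le_rfl).trans hΔ
  rw [ENNReal.ofReal_le_ofReal_iff hD, V.setIntegral_mass hΩ, W.setIntegral_mass hΩ,
    integral_const_mul, integral_const_mul, ← mul_sub, abs_mul, abs_of_pos (inv_pos.2 hA),
    inv_mul_le_iff₀ hA] at h1
  exact h1

/-- Duality: the scalar estimate is applied to ⟨v, g⟩ with v the difference of the integrals itself,
so no dimensional constant appears. -/
lemma norm_integral_sub_le (hΩ : IsOpen Ω) {r s D A : ℝ} (hsr : s < r) (hD : 0 ≤ D)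
    (hsΩ : Metric.closedBall x s ⊆ Ω)
    (hΔ : boundedLipschitzDist Ω (Metric.ball x r) V.mass W.mass ≤ ENNReal.ofReal D)
    {g : E n → E n} (hA : 0 < A) (hgl : ∀ y y', ‖g y - g y'‖ ≤ A * ‖y - y'‖)
    (hgb : ∀ y, ‖g y‖ ≤ A) (hgs : ∀ y, y ∉ Metric.closedBall x s → g y = 0) :
    ‖∫ y, g y ∂V.mass - ∫ y, g y ∂W.mass‖ ≤ A * D := by
  set v := ∫ y, g y ∂V.mass - ∫ y, g y ∂W.mass with hv
  rcases eq_or_ne v 0 with h | h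
  · rw [h, norm_zero]
    positivity
  have hgc : Continuous g := (LipschitzWith.of_dist_le_mul (K := ⟨A, hA.le⟩) fun y y' => by
    rw [dist_eq_norm, dist_eq_norm]; exact hgl y y').continuous
  have hvp := norm_pos_iff.2 h
  have i1 := V.integrable_mass (isCompact_closedBall x s) hsΩ hgc hgs
  have i2 := W.integrable_mass (isCompact_closedBall x s) hsΩ hgc hgs
  have h1 := abs_integral_sub_le hΩ hsr hD hΔ (g := fun y => inner ℝ v (g y)) (mul_pos hvp hA)
    (fun y y' => by
      rw [← inner_sub_right, mul_assoc]
      exact (abs_real_inner_le_norm _ _).trans (mul_le_mul_of_nonneg_left (hgl y y') hvp.le))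
    (fun y => (abs_real_inner_le_norm _ _).trans (mul_le_mul_of_nonneg_left (hgb y) hvp.le))
    (fun y hy => by rw [hgs y hy, inner_zero_right])
  rw [integral_inner i1, integral_inner i2, ← inner_sub_right, ← hv, real_inner_self_eq_norm_sq,
    abs_of_nonneg (sq_nonneg _), sq, mul_assoc] at h1
  exact le_of_mul_le_mul_left h1 hvp

lemma norm_integral_le_mul_measureReal {X G : Type*} [MeasurableSpace X] [NormedAddCommGroup G]
    [NormedSpace ℝ G] {μ : Measure X} {s : Set X} (hs : μ s < ∞) {f : X → G} {c : ℝ}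
    (hf : ∀ᵐ p ∂μ, p ∈ s → ‖f p‖ ≤ c) (hf0 : ∀ p, p ∉ s → f p = 0) :
    ‖∫ p, f p ∂μ‖ ≤ c * μ.real s := by
  rw [← setIntegral_eq_integral_of_forall_compl_eq_zero hf0]
  exact norm_setIntegral_le_of_norm_le_const_ae' hs hf

lemma Varifold.mass_closedBall_lt_top (V : Varifold d n Ω) {r : ℝ}
    (h : Metric.closedBall x r ⊆ Ω) : V.mass (Metric.closedBall x r) < ∞ :=
  V.mass_lt_top_of_isCompact (isCompact_closedBall x r) h

/-- A bound on the mass of one varifold in a ball is inherited by varifolds that are close to it in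
the localized bounded Lipschitz distance. -/
lemma measureReal_closedBall_le (hΩ : IsOpen Ω) {ε D B : ℝ} (hε : 0 < ε) (hε1 : ε ≤ 1)
    (hD : 0 ≤ D) (hεΩ : Metric.closedBall x (3 * ε) ⊆ Ω)
    (hΔ : boundedLipschitzDist Ω (Metric.ball x (4 * ε)) V.mass W.mass ≤ ENNReal.ofReal D)
    (hB : V.mass.real (Metric.closedBall x (3 * ε)) ≤ B) :
    ε * W.mass.real (Metric.closedBall x (2 * ε)) ≤ ε * B + D := by
  -- A truncated cone of slope 1, equal to ε on the ball of radius 2ε and to 0 outside radius 3ε.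
  let g : E n → ℝ := fun y => max 0 (min ε (3 * ε - ‖y - x‖))
  have hgc : Continuous g := by fun_prop
  have hg0 : ∀ y, 0 ≤ g y := fun y => le_max_left _ _
  have hgε : ∀ y, g y ≤ ε := fun y => max_le hε.le (min_le_left _ _)
  have hgs : ∀ y, y ∉ Metric.closedBall x (3 * ε) → g y = 0 := fun y hy => by
    rw [mem_closedBall_iff_norm, not_le] at hy
    exact max_eq_left ((min_le_right _ _).trans (by linarith))
  have h1 := abs_integral_sub_le hΩ (by linarith : 3 * ε < 4 * ε) hD hΔ (g := g) zero_lt_one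
    (fun y y' => by
      rw [one_mul]
      refine (abs_max_sub_max_le_max _ _ _ _).trans (max_le (by simp) ?_)
      refine (abs_min_sub_min_le_max _ _ _ _).trans (max_le (by simp) ?_)
      rw [sub_sub_sub_cancel_left, abs_sub_comm]
      refine (abs_norm_sub_norm_le _ _).trans (le_of_eq ?_)
      congr 1
      abel)
    (fun y => by rw [abs_of_nonneg (hg0 y)]; exact (hgε y).trans hε1) hgs
  rw [one_mul] at h1
  have h2 : ∫ y, g y ∂V.mass ≤ ε * B := by
    refine (le_abs_self _).trans ((norm_integral_le_mul_measureReal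
      (V.mass_closedBall_lt_top hεΩ) (c := ε) (Eventually.of_forall fun y _ => ?_) hgs).trans
      (mul_le_mul_of_nonneg_left hB hε.le))
    rw [Real.norm_eq_abs, abs_of_nonneg (hg0 y)]
    exact hgε y
  have hiW := W.integrable_mass (isCompact_closedBall x (3 * ε)) hεΩ hgc hgs
  have h3 : ε * W.mass.real (Metric.closedBall x (2 * ε)) ≤ ∫ y, g y ∂W.mass := by
    have h4 : ∀ y ∈ Metric.closedBall x (2 * ε), ε ≤ g y := fun y hy => by
      rw [mem_closedBall_iff_norm] at hy
      exact le_max_of_le_right (le_min le_rfl (by linarith))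
    refine le_trans ?_ (setIntegral_le_integral hiW (Eventually.of_forall hg0)
      (s := Metric.closedBall x (2 * ε)))
    have h5 := setIntegral_ge_of_const_le_real (μ := W.mass) (c := ε) measurableSet_closedBall
      (W.mass_closedBall_lt_top
        ((Metric.closedBall_subset_closedBall (by linarith)).trans hεΩ)).ne h4 hiW.integrableOn
    exact h5
  have := abs_le.1 h1
  linarith [this.1]

lemma scaled_sub_le {G : Type*} [SeminormedAddCommGroup G] {φ : E n → G} {K ε : ℝ} (hε : 0 < ε)
    (hφl : ∀ u v, ‖φ u - φ v‖ ≤ K * ‖u - v‖) (y y' x x' : E n) :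
    ‖φ (ε⁻¹ • (y - x)) - φ (ε⁻¹ • (y' - x'))‖ ≤ K * ε⁻¹ * ‖(y - x) - (y' - x')‖ := by
  refine (hφl _ _).trans (le_of_eq ?_)
  rw [← smul_sub, norm_smul, norm_inv, Real.norm_eq_abs, abs_of_pos hε, mul_assoc]

lemma continuous_of_lipschitz {F G : Type*} [SeminormedAddCommGroup F] [SeminormedAddCommGroup G]
    {φ : F → G} {K : ℝ} (hK : 0 ≤ K) (hφl : ∀ u v, ‖φ u - φ v‖ ≤ K * ‖u - v‖) : Continuous φ :=
  (LipschitzWith.of_dist_le_mul (K := ⟨K, hK⟩) fun y y' => by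
    rw [dist_eq_norm, dist_eq_norm]; exact hφl y y').continuous

lemma ball_subset_closedBall_two_mul {ε : ℝ} (hz : ‖x - z‖ ≤ ε) :
    Metric.closedBall z ε ⊆ Metric.closedBall x (2 * ε) :=
  Metric.closedBall_subset_closedBall' (by rw [dist_comm, dist_eq_norm]; linarith)

lemma scaled_eq_zero {G : Type*} [Zero G] {φ : E n → G} (hφ0 : ∀ w, 1 ≤ ‖w‖ → φ w = 0) {ε : ℝ}
    (hε : 0 < ε) (hz : ‖x - z‖ ≤ ε) {y : E n} (hy : y ∉ Metric.closedBall x (2 * ε)) :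
    φ (ε⁻¹ • (y - z)) = 0 :=
  notMem_closedBall_scaled hφ0 hε fun h =>
    hy (ball_subset_closedBall_two_mul hz (Metric.ball_subset_closedBall h))

/-- On the ball of radius 2ε the field h has size at most 2κε, which cancels the Lipschitz constant
K/ε of the rescaled kernel: moving the centre costs no negative power of ε. -/
lemma norm_integral_shift_le {ε K B : ℝ} (hε : 0 < ε) (hz : ‖x - z‖ ≤ ε)
    (hεΩ : Metric.closedBall x (2 * ε) ⊆ Ω)
    (hB : W.mass.real (Metric.closedBall x (2 * ε)) ≤ B) {h : E n → (E n →L[ℝ] E n)} {κ : ℝ}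
    (hh : Continuous h) (hK : 0 ≤ K) (hκ : 0 ≤ κ)
    (hhb : ∀ y, ‖h y‖ ≤ κ * ‖y - x‖) {φ : E n → E n}
    (hφl : ∀ u v, ‖φ u - φ v‖ ≤ K * ‖u - v‖) (hφ0 : ∀ w, 1 ≤ ‖w‖ → φ w = 0) :
    ‖∫ y, h y (φ (ε⁻¹ • (y - z))) ∂W.mass - ∫ y, h y (φ (ε⁻¹ • (y - x))) ∂W.mass‖ ≤
      2 * κ * K * ‖x - z‖ * B := by
  have hφc := continuous_of_lipschitz hK hφl
  have hxx : ‖x - x‖ ≤ ε := by simpa using hε.le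
  have hi : ∀ z, ‖x - z‖ ≤ ε → Integrable (fun y => h y (φ (ε⁻¹ • (y - z)))) W.mass :=
    fun z hz => W.integrable_mass (isCompact_closedBall x (2 * ε)) hεΩ (by fun_prop)
      fun y hy => by rw [scaled_eq_zero hφ0 hε hz hy, map_zero]
  rw [← integral_sub (hi z hz) (hi x hxx)]
  refine (norm_integral_le_mul_measureReal (c := 2 * κ * K * ‖x - z‖)
    (W.mass_closedBall_lt_top hεΩ) (Eventually.of_forall fun y hy => ?_) fun y hy => ?_).trans
    (mul_le_mul_of_nonneg_left hB (by positivity))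
  · rw [← map_sub]
    refine ((h y).le_opNorm _).trans ?_
    have h1 := scaled_sub_le hε hφl y y z x
    rw [sub_sub_sub_cancel_left] at h1
    rw [mem_closedBall_iff_norm] at hy
    have h2 : ‖h y‖ ≤ κ * (2 * ε) := (hhb y).trans (mul_le_mul_of_nonneg_left hy hκ)
    refine (mul_le_mul h2 h1 (norm_nonneg _) (by positivity)).trans (le_of_eq ?_)
    field_simp
  · rw [scaled_eq_zero hφ0 hε hz hy, scaled_eq_zero hφ0 hε hxx hy, sub_self]

/-- Here nothing compensates the Lipschitz constant K/ε: first the centre moves from z to x under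
‖W‖, then ‖W‖ is exchanged for ‖V‖. -/
lemma abs_integral_scaled_sub_le (hΩ : IsOpen Ω) {ε K B D : ℝ} (hε : 0 < ε) (hε1 : ε ≤ 1)
    (hz : ‖x - z‖ ≤ ε) (hεΩ : Metric.closedBall x (2 * ε) ⊆ Ω) (hD : 0 ≤ D)
    (hΔ : boundedLipschitzDist Ω (Metric.ball x (4 * ε)) V.mass W.mass ≤ ENNReal.ofReal D)
    (hB : W.mass.real (Metric.closedBall x (2 * ε)) ≤ B) (hK : 0 < K) {φ : E n → ℝ}
    (hφl : ∀ u v, |φ u - φ v| ≤ K * ‖u - v‖) (hφb : ∀ u, |φ u| ≤ K)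
    (hφ0 : ∀ w, 1 ≤ ‖w‖ → φ w = 0) :
    |∫ y, φ (ε⁻¹ • (y - z)) ∂W.mass - ∫ y, φ (ε⁻¹ • (y - x)) ∂V.mass| ≤
      K * ε⁻¹ * (‖x - z‖ * B + D) := by
  have hφl' : ∀ u v, ‖φ u - φ v‖ ≤ K * ‖u - v‖ := hφl
  have hφc := continuous_of_lipschitz hK.le hφl'
  have hxx : ‖x - x‖ ≤ ε := by simpa using hε.le
  have hi : ∀ z, ‖x - z‖ ≤ ε → Integrable (fun y => φ (ε⁻¹ • (y - z))) W.mass :=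
    fun z hz => W.integrable_mass (isCompact_closedBall x (2 * ε)) hεΩ (by fun_prop)
      fun y hy => scaled_eq_zero hφ0 hε hz hy
  have h1 : |∫ y, φ (ε⁻¹ • (y - z)) ∂W.mass - ∫ y, φ (ε⁻¹ • (y - x)) ∂W.mass| ≤
      K * ε⁻¹ * ‖x - z‖ * B := by
    rw [← integral_sub (hi z hz) (hi x hxx), ← Real.norm_eq_abs]
    refine (norm_integral_le_mul_measureReal (c := K * ε⁻¹ * ‖x - z‖)
      (W.mass_closedBall_lt_top hεΩ) (Eventually.of_forall fun y hy => ?_) fun y hy => ?_).trans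
      (mul_le_mul_of_nonneg_left hB (by positivity))
    · have h1 := scaled_sub_le hε hφl' y y z x
      rwa [sub_sub_sub_cancel_left] at h1
    · rw [scaled_eq_zero hφ0 hε hz hy, scaled_eq_zero hφ0 hε hxx hy, sub_self]
  have h2 := abs_integral_sub_le hΩ (by linarith : 2 * ε < 4 * ε) hD hΔ
    (g := fun y => φ (ε⁻¹ • (y - x))) (A := K * ε⁻¹) (by positivity)
    (fun y y' => by
      have := scaled_sub_le hε hφl' y y' x x
      rwa [sub_sub_sub_cancel_right] at this)
    (fun y => (hφb _).trans (le_mul_of_one_le_right hK.le ((one_le_inv₀ hε).2 hε1)))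
    (fun y hy => scaled_eq_zero hφ0 hε hxx hy)
  rw [abs_sub_comm] at h2
  refine (abs_sub_le _ (∫ y, φ (ε⁻¹ • (y - x)) ∂W.mass) _).trans ?_
  linarith

/-- The product of h, which vanishes at x, with the rescaled kernel is Lipschitz with constant 2κK
uniformly in ε: one κK from |h| ≤ κε times K/ε, the other from the variation of h times the bound K.
-/
lemma norm_integral_clm_scaled_sub_le (hΩ : IsOpen Ω) {ε K D κ : ℝ} (hε : 0 < ε) (hε1 : ε ≤ 1)
    (hεΩ : Metric.closedBall x ε ⊆ Ω) (hD : 0 ≤ D)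
    (hΔ : boundedLipschitzDist Ω (Metric.ball x (4 * ε)) V.mass W.mass ≤ ENNReal.ofReal D)
    (hK : 0 < K) (hκ : 0 < κ) {h : E n → (E n →L[ℝ] E n)}
    (hhl : ∀ y y', ‖h y - h y'‖ ≤ κ * ‖y - y'‖) (hhx : h x = 0) {φ : E n → E n}
    (hφl : ∀ u v, ‖φ u - φ v‖ ≤ K * ‖u - v‖) (hφb : ∀ u, ‖φ u‖ ≤ K)
    (hφ0 : ∀ w, 1 ≤ ‖w‖ → φ w = 0) :
    ‖∫ y, h y (φ (ε⁻¹ • (y - x))) ∂V.mass - ∫ y, h y (φ (ε⁻¹ • (y - x))) ∂W.mass‖ ≤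
      2 * κ * K * D := by
  have hhb : ∀ y, ‖h y‖ ≤ κ * ‖y - x‖ := fun y => by simpa [hhx] using hhl y x
  have hz : ∀ y, y ∉ Metric.closedBall x ε → φ (ε⁻¹ • (y - x)) = 0 := fun y hy =>
    notMem_closedBall_scaled hφ0 hε fun h => hy (Metric.ball_subset_closedBall h)
  have hin : ∀ y y', y ∈ Metric.closedBall x ε →
      ‖h y (φ (ε⁻¹ • (y - x))) - h y' (φ (ε⁻¹ • (y' - x)))‖ ≤ 2 * κ * K * ‖y - y'‖ := by
    intro y y' hy
    rw [mem_closedBall_iff_norm] at hy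
    have e : h y (φ (ε⁻¹ • (y - x))) - h y' (φ (ε⁻¹ • (y' - x))) =
        h y (φ (ε⁻¹ • (y - x)) - φ (ε⁻¹ • (y' - x))) + (h y - h y') (φ (ε⁻¹ • (y' - x))) := by
      simp
    have h1 := scaled_sub_le hε hφl y y' x x
    rw [sub_sub_sub_cancel_right] at h1
    have h2 : ‖h y (φ (ε⁻¹ • (y - x)) - φ (ε⁻¹ • (y' - x)))‖ ≤ κ * K * ‖y - y'‖ := by
      refine ((h y).le_opNorm _).trans ((mul_le_mul ((hhb y).trans
        (mul_le_mul_of_nonneg_left hy hκ.le)) h1 (norm_nonneg _) (by positivity)).trans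
        (le_of_eq ?_))
      field_simp
    have h3 : ‖(h y - h y') (φ (ε⁻¹ • (y' - x)))‖ ≤ κ * K * ‖y - y'‖ := by
      refine ((h y - h y').le_opNorm _).trans ((mul_le_mul (hhl y y') (hφb _) (norm_nonneg _)
        (by positivity)).trans (le_of_eq ?_))
      ring
    rw [e]
    refine (norm_add_le _ _).trans ?_
    linarith
  refine norm_integral_sub_le hΩ (by linarith : ε < 4 * ε) hD hεΩ hΔ (by positivity)
    (fun y y' => ?_) (fun y => ?_) fun y hy => by rw [hz y hy, map_zero]
  · by_cases hy : y ∈ Metric.closedBall x ε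
    · exact hin y y' hy
    by_cases hy' : y' ∈ Metric.closedBall x ε
    · rw [norm_sub_rev, norm_sub_rev y]
      exact hin y' y hy'
    · rw [hz y hy, hz y' hy', map_zero, map_zero, sub_zero, norm_zero]
      positivity
  · by_cases hy : y ∈ Metric.closedBall x ε
    · rw [mem_closedBall_iff_norm] at hy
      have h1 : ‖h y‖ ≤ κ * 1 := (hhb y).trans (mul_le_mul_of_nonneg_left (hy.trans hε1) hκ.le)
      refine ((h y).le_opNorm _).trans ((mul_le_mul h1 (hφb _) (norm_nonneg _)
        (by positivity)).trans ?_)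
      nlinarith [mul_pos hκ hK]
    · rw [hz y hy, map_zero, norm_zero]
      positivity

lemma norm_le_one_of_mem_Gr {S : E n →L[ℝ] E n} (hS : S ∈ Gr d n) : ‖S‖ ≤ 1 := hS.1.norm_le

lemma Varifold.measure_preimage_fst (V : Varifold d n Ω) {A : Set (E n)} (hA : MeasurableSet A) :
    V.measure (Prod.fst ⁻¹' A) = V.mass A :=
  (Measure.map_apply measurable_fst hA).symm

/-- The first variation of a varifold tested against a bounded kernel is bounded by the mass. -/
lemma norm_integral_apply_le {ε K B : ℝ} (hε : 0 < ε) (hz : ‖x - z‖ ≤ ε)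
    (hεΩ : Metric.closedBall x (2 * ε) ⊆ Ω)
    (hB : W.mass.real (Metric.closedBall x (2 * ε)) ≤ B) (hK : 0 ≤ K) {φ : E n → E n}
    (hφb : ∀ u, ‖φ u‖ ≤ K) (hφ0 : ∀ w, 1 ≤ ‖w‖ → φ w = 0) :
    ‖∫ p, p.2 (φ (ε⁻¹ • (p.1 - z))) ∂W.measure‖ ≤ K * B := by
  have hpre := W.measure_preimage_fst (A := Metric.closedBall x (2 * ε)) measurableSet_closedBall
  have h1 := norm_integral_le_mul_measureReal (μ := W.measure)
    (s := Prod.fst ⁻¹' Metric.closedBall x (2 * ε)) (f := fun p => p.2 (φ (ε⁻¹ • (p.1 - z))))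
    (c := K) (by rw [hpre]; exact W.mass_closedBall_lt_top hεΩ) ?_ fun p hp => by
      rw [scaled_eq_zero hφ0 hε hz hp, map_zero]
  · rw [measureReal_def, hpre, ← measureReal_def] at h1
    exact h1.trans (mul_le_mul_of_nonneg_left hB hK)
  · filter_upwards [W.ae_mem_Gr] with p hp _
    refine (p.2.le_opNorm _).trans ?_
    exact (mul_le_mul (norm_le_one_of_mem_Gr hp) (hφb _) (norm_nonneg _) zero_le_one).trans
      (one_mul K).le

lemma integrable_apply {ε K : ℝ} (hε : 0 < ε) (hz : ‖x - z‖ ≤ ε)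
    (hεΩ : Metric.closedBall x (2 * ε) ⊆ Ω) {φ : E n → E n} (hφc : Continuous φ)
    (hφb : ∀ u, ‖φ u‖ ≤ K) (hφ0 : ∀ w, 1 ≤ ‖w‖ → φ w = 0) :
    Integrable (fun p => p.2 (φ (ε⁻¹ • (p.1 - z)))) W.measure := by
  have hpre := W.measure_preimage_fst (A := Metric.closedBall x (2 * ε)) measurableSet_closedBall
  refine (integrableOn_iff_integrable_of_support_subset
    (s := Prod.fst ⁻¹' Metric.closedBall x (2 * ε)) ?_).1 ?_
  · intro p hp
    by_contra h
    exact hp (by simp only [scaled_eq_zero hφ0 hε hz h, map_zero])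
  · refine Measure.integrableOn_of_bounded (M := K)
      (by rw [hpre]; exact (W.mass_closedBall_lt_top hεΩ).ne)
      (by fun_prop : Continuous fun p : E n × (E n →L[ℝ] E n) =>
        p.2 (φ (ε⁻¹ • (p.1 - z)))).aestronglyMeasurable ?_
    filter_upwards [ae_restrict_of_ae W.ae_mem_Gr] with p hp
    refine (p.2.le_opNorm _).trans ?_
    exact (mul_le_mul (norm_le_one_of_mem_Gr hp) (hφb _) (norm_nonneg _) zero_le_one).trans
      (one_mul K).le

lemma integrable_of_carried {μ : Measure (E n →L[ℝ] E n)} [IsProbabilityMeasure μ]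
    (hμ : μ (Gr d n)ᶜ = 0) {G : Type*} [NormedAddCommGroup G] [SecondCountableTopology G]
    {f : (E n →L[ℝ] E n) → G} (hf : Continuous f) {C : ℝ} (hC : ∀ S ∈ Gr d n, ‖f S‖ ≤ C) :
    Integrable f μ := by
  refine Integrable.of_bound hf.aestronglyMeasurable C ?_
  have : ∀ᵐ S ∂μ, S ∈ Gr d n := hμ
  filter_upwards [this] with S hS using hC S hS

lemma integrable_sub_of_carried {μ : Measure (E n →L[ℝ] E n)} [IsProbabilityMeasure μ]
    (hμ : μ (Gr d n)ᶜ = 0) (A : E n →L[ℝ] E n) : Integrable (fun S => A - S) μ :=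
  integrable_of_carried hμ (by fun_prop) (C := ‖A‖ + 1) fun S hS =>
    (norm_sub_le _ _).trans (by linarith [norm_le_one_of_mem_Gr hS])

/-- The tangential part of a varifold may be replaced by an approximation `T` in the first
variation, up to the averaged distance of `T` to the Young measure. -/
lemma norm_integral_apply_sub_le {ν : ProbabilityTheory.Kernel (E n) (E n →L[ℝ] E n)}
    (hν : IsYoungMeasure W ν) {ε K B δ : ℝ} (hε : 0 < ε)
    (hz : ‖x - z‖ ≤ ε) (hεΩ : Metric.closedBall x (2 * ε) ⊆ Ω)
    (hB : W.mass.real (Metric.closedBall x (2 * ε)) ≤ B) (hK : 0 ≤ K) (hδ : 0 ≤ δ)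
    {T : E n → (E n →L[ℝ] E n)} (hT : Continuous T)
    (hTν : ∀ᵐ y ∂W.mass, y ∈ Metric.ball z ε → ∫ S, ‖T y - S‖ ∂(ν y) ≤ δ)
    {Q : E n →L[ℝ] E n} (hQ : ‖Q‖ ≤ 1) {φ : E n → E n} (hφc : Continuous φ)
    (hφb : ∀ u, ‖φ u‖ ≤ K) (hφ0 : ∀ w, 1 ≤ ‖w‖ → φ w = 0) :
    ‖Q (∫ p, p.2 (φ (ε⁻¹ • (p.1 - z))) ∂W.measure) -
      ∫ y, Q (T y (φ (ε⁻¹ • (y - z)))) ∂W.mass‖ ≤ K * δ * B := by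
  have := hν.isMarkov
  have i1 := integrable_apply (W := W) hε hz hεΩ hφc hφb hφ0
  have hc2 : Continuous fun y => Q (T y (φ (ε⁻¹ • (y - z)))) := by fun_prop
  have i2 : Integrable (fun y => Q (T y (φ (ε⁻¹ • (y - z))))) W.mass :=
    W.integrable_mass (isCompact_closedBall x (2 * ε)) hεΩ hc2
      fun y hy => by rw [scaled_eq_zero hφ0 hε hz hy, map_zero, map_zero]
  have i2' : Integrable (fun p => Q (T p.1 (φ (ε⁻¹ • (p.1 - z))))) W.measure :=
    i2.comp_measurable measurable_fst
  have e2 : ∫ y, Q (T y (φ (ε⁻¹ • (y - z)))) ∂W.mass =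
      ∫ p, Q (T p.1 (φ (ε⁻¹ • (p.1 - z)))) ∂W.measure :=
    integral_map measurable_fst.aemeasurable hc2.aestronglyMeasurable
  rw [e2, ← Q.integral_comp_comm i1, ← integral_sub (Q.integrable_comp i1) i2']
  have hmain : ∫⁻ p, ‖Q (p.2 (φ (ε⁻¹ • (p.1 - z)))) - Q (T p.1 (φ (ε⁻¹ • (p.1 - z))))‖ₑ ∂W.measure ≤
      ENNReal.ofReal (K * δ) * W.mass (Metric.closedBall x (2 * ε)) := by
    -- The disintegration is given for nonnegative measurable functions, so the integrand is
    -- dominated by Φ. The indicator keeps only points y where the averaged distance is controlled.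
    let Φ : E n × (E n →L[ℝ] E n) → ℝ≥0∞ := fun p =>
      (Metric.ball z ε).indicator (fun _ => ENNReal.ofReal K) p.1 * ‖T p.1 - p.2‖ₑ
    have hΦ : Measurable Φ := by
      refine Measurable.mul ?_ ?_
      · exact (measurable_const.indicator Metric.isOpen_ball.measurableSet).comp measurable_fst
      · exact (by fun_prop : Continuous fun p : E n × (E n →L[ℝ] E n) =>
          T p.1 - p.2).enorm.measurable
    calc ∫⁻ p, ‖Q (p.2 (φ (ε⁻¹ • (p.1 - z)))) - Q (T p.1 (φ (ε⁻¹ • (p.1 - z))))‖ₑ ∂W.measure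
        ≤ ∫⁻ p, Φ p ∂W.measure := by
          refine lintegral_mono fun p => ?_
          by_cases hp : p.1 ∈ Metric.ball z ε
          · simp only [Φ, indicator_of_mem hp]
            rw [← map_sub, ← sub_apply, ← ofReal_norm, ← ofReal_norm,
              ← ENNReal.ofReal_mul hK]
            refine ENNReal.ofReal_le_ofReal ((Q.le_opNorm _).trans ?_)
            refine (mul_le_mul hQ ((p.2 - T p.1).le_opNorm _) (norm_nonneg _) zero_le_one).trans ?_
            rw [one_mul, norm_sub_rev, mul_comm]
            exact mul_le_mul_of_nonneg_right (hφb _) (norm_nonneg _)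
          · rw [notMem_closedBall_scaled hφ0 hε hp]
            simp
      _ = ∫⁻ y, ∫⁻ S, Φ (y, S) ∂(ν y) ∂W.mass := hν.disintegration Φ hΦ
      _ ≤ ∫⁻ y, (Metric.closedBall x (2 * ε)).indicator (fun _ => ENNReal.ofReal (K * δ)) y
            ∂W.mass := by
          refine lintegral_mono_ae ?_
          filter_upwards [hTν] with y hy
          by_cases hyb : y ∈ Metric.ball z ε
          · rw [indicator_of_mem (ball_subset_closedBall_two_mul hz
              (Metric.ball_subset_closedBall hyb))]
            simp only [Φ, indicator_of_mem hyb]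
            rw [lintegral_const_mul' _ _ ENNReal.ofReal_ne_top,
              ← ofReal_integral_norm_eq_lintegral_enorm
                (integrable_sub_of_carried (hν.carried y) (T y)),
              ← ENNReal.ofReal_mul hK]
            exact ENNReal.ofReal_le_ofReal (mul_le_mul_of_nonneg_left (hy hyb) hK)
          · simp only [Φ, indicator_of_notMem hyb, zero_mul, lintegral_zero]
            exact zero_le
      _ = ENNReal.ofReal (K * δ) * W.mass (Metric.closedBall x (2 * ε)) :=
          lintegral_indicator_const measurableSet_closedBall _
  rw [← toReal_enorm]
  refine (ENNReal.toReal_mono (ENNReal.mul_ne_top ENNReal.ofReal_ne_top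
    (W.mass_closedBall_lt_top hεΩ).ne)
    ((enorm_integral_le_lintegral_enorm _).trans hmain)).trans ?_
  rw [ENNReal.toReal_mul, ENNReal.toReal_ofReal (by positivity)]
  exact mul_le_mul_of_nonneg_left hB (by positivity)

/-- A serves as intermediate projection: the difference is the average of (A - S)v minus (A - P)v.
In the application A is the extended tangent field at z and P the tangent projection at x. -/
lemma norm_orthogonal_average_sub_le {μ : Measure (E n →L[ℝ] E n)} [IsProbabilityMeasure μ]
    (hμ : μ (Gr d n)ᶜ = 0) {A P : E n →L[ℝ] E n} {δ δ' : ℝ} (hA : ∫ S, ‖A - S‖ ∂μ ≤ δ)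
    (hAP : ‖A - P‖ ≤ δ') (v : E n) :
    ‖∫ S, (v - S v) ∂μ - (v - P v)‖ ≤ (δ + δ') * ‖v‖ := by
  have i1 := integrable_sub_of_carried hμ A
  have i2 : Integrable (fun S => (A - S) v) μ :=
    (ContinuousLinearMap.apply ℝ (E n) v).integrable_comp i1
  have e : ∫ S, (v - S v) ∂μ - (v - P v) = ∫ S, (A - S) v ∂μ - (A - P) v := by
    have : (fun S : E n →L[ℝ] E n => v - S v) = fun S => (A - S) v + (v - A v) :=
      funext fun S => by rw [sub_apply]; abel
    rw [this, integral_add i2 (integrable_const _), integral_const, probReal_univ, one_smul, sub_apply]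
    abel
  have h1 : ‖∫ S, (A - S) v ∂μ‖ ≤ δ * ‖v‖ := by
    refine (norm_integral_le_integral_norm _).trans ((integral_mono i2.norm (i1.norm.mul_const ‖v‖)
      fun S => (A - S).le_opNorm v).trans ?_)
    rw [integral_mul_const]
    exact mul_le_mul_of_nonneg_right hA (norm_nonneg _)
  rw [e, add_mul]
  exact (norm_sub_le _ _).trans (add_le_add h1 (((A - P).le_opNorm v).trans
    (mul_le_mul_of_nonneg_right hAP (norm_nonneg _))))

end Comparison

/-! ### Blow-up limits of mass and normal first variation; identification of the mean curvature -/

section Limits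

variable {d n : ℕ} {Ω : Set (E n)} {V : Varifold d n Ω} {M : Set (E n)} {x z : E n} {ρ ξ : ℝ → ℝ}

/-- The convolution of the mass with the unnormalized kernel `ξ(|y| / ε)`. -/
def kernelMass (V : Varifold d n Ω) (ξ : ℝ → ℝ) (ε : ℝ) (z : E n) : ℝ :=
  ∫ y, ξ ‖ε⁻¹ • (y - z)‖ ∂V.mass

/-- The first variation tested with the unnormalized gradient of `ρ(|y| / ε)`. -/
def kernelVariation (V : Varifold d n Ω) (ρ : ℝ → ℝ) (ε : ℝ) (z : E n) : E n :=
  ∫ p, p.2 (radialGrad ρ (ε⁻¹ • (p.1 - z))) ∂V.measure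

lemma regularizedMass_eq (V : Varifold d n Ω) (ξ : ℝ → ℝ) {ε : ℝ} (hε : 0 < ε) (z : E n) :
    regularizedMass V ξ ε z = (ε ^ n)⁻¹ * kernelMass V ξ ε z := by
  rw [regularizedMass, kernelMass, ← integral_const_mul]
  refine integral_congr_ae (Eventually.of_forall fun y => ?_)
  simp only [scaledKernel]
  rw [norm_smul, norm_inv, Real.norm_eq_abs, abs_of_pos hε, norm_sub_rev, div_eq_inv_mul]

lemma regularizedMass_pos_iff (V : Varifold d n Ω) (ξ : ℝ → ℝ) {ε : ℝ} (hε : 0 < ε) (z : E n) :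
    0 < regularizedMass V ξ ε z ↔ 0 < kernelMass V ξ ε z := by
  rw [regularizedMass_eq V ξ hε z]
  exact mul_pos_iff_of_pos_left (by positivity)

lemma approxMeanCurvature_eq (V : Varifold d n Ω) (hρ : Differentiable ℝ ρ) (h0 : deriv ρ 0 = 0)
    (ξ : ℝ → ℝ) {ε : ℝ} (hε : 0 < ε) (z : E n) :
    approxMeanCurvature V ρ ξ ε z =
      -((kernelConst d ξ / kernelConst d ρ * (kernelMass V ξ ε z)⁻¹ * ε⁻¹) •
        kernelVariation V ρ ε z) := by
  have h1 : regularizedFirstVariation V ρ ε z = ((ε ^ n)⁻¹ * ε⁻¹) • kernelVariation V ρ ε z := by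
    rw [regularizedFirstVariation, kernelVariation, ← integral_smul]
    refine integral_congr_ae (Eventually.of_forall fun p => ?_)
    simp only
    rw [(hasGradientAt_scaledKernel hρ h0 hε (p.1 - z)).gradient, map_smul]
  rw [approxMeanCurvature, h1, regularizedMass_eq V ξ hε z, smul_smul]
  congr 2
  have : ε ^ n ≠ 0 := by positivity
  rw [mul_inv, inv_inv]
  field_simp

variable {ι : E d →ₗᵢ[ℝ] E n}

lemma exists_mass_bound (hΩ : IsOpen Ω) (hx : x ∈ Ω)
    (hι : ∀ φ : E n → ℝ, Continuous φ → (∀ w, 1 ≤ ‖w‖ → φ w = 0) →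
      Tendsto (fun ε : ℝ => (ε ^ d)⁻¹ * ∫ y, φ (ε⁻¹ • (y - x)) ∂V.mass) (𝓝[>] 0)
        (𝓝 (∫ u, φ (ι u)))) :
    ∃ C > 0, ∀ᶠ ε : ℝ in 𝓝[>] 0, Metric.closedBall x (5 * ε) ⊆ Ω ∧
      V.mass.real (Metric.closedBall x (5 * ε)) ≤ C * ε ^ d := by
  -- At scale 10ε this cone is at least 1/2 on the ball of radius 5ε, so its convergent rescaled
  -- integral bounds the mass there.
  let φ : E n → ℝ := fun w => max 0 (1 - ‖w‖)
  have hφc : Continuous φ := by fun_prop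
  have hφ0 : ∀ w, 1 ≤ ‖w‖ → φ w = 0 := fun w hw => max_eq_left (by linarith)
  have hφn : ∀ w, 0 ≤ φ w := fun w => le_max_left _ _
  have h1 := hι φ hφc hφ0
  set L := ∫ u, φ (ι u) with hL
  have hL0 : 0 ≤ L := integral_nonneg fun u => hφn _
  have hten : Tendsto (fun ε : ℝ => 10 * ε) (𝓝[>] 0) (𝓝[>] 0) := by
    refine tendsto_nhdsWithin_iff.2 ⟨?_, ?_⟩
    · have : Continuous fun ε : ℝ => 10 * ε := by fun_prop
      simpa using (this.tendsto 0).mono_left nhdsWithin_le_nhds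
    · filter_upwards [self_mem_nhdsWithin] with ε hε
      have hε' : 0 < ε := hε
      exact (by positivity : (0 : ℝ) < 10 * ε)
  refine ⟨2 * 10 ^ d * (L + 1), by positivity, ?_⟩
  filter_upwards [self_mem_nhdsWithin, hten.eventually (h1.eventually_lt_const (lt_add_one L)),
    hten.eventually (eventually_closedBall_subset hΩ hx)] with ε hε h2 hεΩ
  have hε' : 0 < ε := hε
  have h10 : 0 < 10 * ε := by positivity
  rw [inv_mul_lt_iff₀ (by positivity)] at h2
  have hi := V.integrable_scaled hφc hφ0 h10 hεΩ
  have h5 : Metric.closedBall x (5 * ε) ⊆ Ω :=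
    (Metric.closedBall_subset_closedBall (by linarith)).trans hεΩ
  have h3 := setIntegral_ge_of_const_le_real (μ := V.mass) (c := 1 / 2)
    (s := Metric.closedBall x (5 * ε)) measurableSet_closedBall (V.mass_closedBall_lt_top h5).ne
    (fun y hy => by
      rw [mem_closedBall_iff_norm] at hy
      refine le_max_of_le_right ?_
      rw [norm_smul, norm_inv, Real.norm_eq_abs, abs_of_pos h10]
      have : (10 * ε)⁻¹ * ‖y - x‖ ≤ 1 / 2 := by
        rw [inv_mul_le_iff₀ h10]
        linarith
      linarith) hi.integrableOn
  have h4 := setIntegral_le_integral hi (Eventually.of_forall fun y => hφn _)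
    (s := Metric.closedBall x (5 * ε))
  have h6 : (10 * ε) ^ d * (L + 1) = 10 ^ d * (L + 1) * ε ^ d := by rw [mul_pow]; ring
  exact ⟨h5, by linarith⟩

lemma tendsto_kernelMass {K : ℝ≥0} (hd : 1 ≤ d) (hξl : LipschitzWith K ξ)
    (hξs : tsupport ξ ⊆ Icc (-1) 1)
    (hι : ∀ φ : E n → ℝ, Continuous φ → (∀ w, 1 ≤ ‖w‖ → φ w = 0) →
      Tendsto (fun ε : ℝ => (ε ^ d)⁻¹ * ∫ y, φ (ε⁻¹ • (y - x)) ∂V.mass) (𝓝[>] 0)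
        (𝓝 (∫ u, φ (ι u)))) :
    Tendsto (fun ε : ℝ => (ε ^ d)⁻¹ * kernelMass V ξ ε x) (𝓝[>] 0) (𝓝 (kernelConst d ξ)) := by
  have h1 := hι (fun w => ξ ‖w‖) (hξl.continuous.comp continuous_norm)
    fun w hw => eq_zero_of_tsupport hξl.continuous hξs hw
  simp only [ι.norm_map] at h1
  rwa [integral_comp_norm (F := E d) hd finrank_euclideanSpace_fin
    fun t ht => eq_zero_of_tsupport hξl.continuous hξs ht] at h1

/-- First-order blow-up of the normal part of the first variation. -/
lemma tendsto_normalVariation (hΩ : IsOpen Ω) (hx : x ∈ Ω)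
    (hι : ∀ φ : E n → ℝ, Continuous φ → (∀ w, 1 ≤ ‖w‖ → φ w = 0) →
      Tendsto (fun ε : ℝ => (ε ^ d)⁻¹ * ∫ y, φ (ε⁻¹ • (y - x)) ∂V.mass) (𝓝[>] 0)
        (𝓝 (∫ u, φ (ι u))))
    {h : E n → (E n →L[ℝ] E n)} (hh : Continuous h) (hhx : h x = 0)
    {h' : E n →L[ℝ] (E n →L[ℝ] E n)} (hd : HasFDerivAt h h' x) {φ : E n → E n}
    (hφc : Continuous φ) {K : ℝ} (hK : 0 ≤ K) (hφb : ∀ u, ‖φ u‖ ≤ K)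
    (hφ0 : ∀ w, 1 ≤ ‖w‖ → φ w = 0) :
    Tendsto (fun ε : ℝ => (ε ^ d)⁻¹ • ε⁻¹ • ∫ y, h y (φ (ε⁻¹ • (y - x))) ∂V.mass) (𝓝[>] 0)
      (𝓝 (∫ u, h' (ι u) (φ (ι u)))) := by
  have hΦc : Continuous fun w => h' w (φ w) := by fun_prop
  have hΦ0 : ∀ w, 1 ≤ ‖w‖ → h' w (φ w) = 0 := fun w hw => by rw [hφ0 w hw, map_zero]
  have h1 := tendsto_blowUp_vector (V := V) hΩ hx hι hΦc hΦ0
  obtain ⟨C, hC, hmass⟩ := exists_mass_bound hΩ hx hι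
  -- By linearity ε⁻¹ h'(y - x) = h'(ε⁻¹(y - x)), so only the first-order Taylor remainder of h is
  -- left. It is o(ε) on a ball of mass O(ε^d).
  have hdiff : Tendsto (fun ε : ℝ => (ε ^ d)⁻¹ • ε⁻¹ • ∫ y, h y (φ (ε⁻¹ • (y - x))) ∂V.mass -
      (ε ^ d)⁻¹ • ∫ y, h' (ε⁻¹ • (y - x)) (φ (ε⁻¹ • (y - x))) ∂V.mass) (𝓝[>] 0) (𝓝 0) := by
    rw [NormedAddGroup.tendsto_nhds_zero]
    intro e he
    set δ := e / (2 * (K * C + 1)) with hδ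
    have hKC : 0 < K * C + 1 := by positivity
    have hδ0 : 0 < δ := by positivity
    have hlo := hd.isLittleO.def hδ0
    obtain ⟨r, hr, hrb⟩ := Metric.eventually_nhds_iff_ball.1 hlo
    filter_upwards [Ioo_mem_nhdsGT hr, hmass, eventually_closedBall_subset hΩ hx] with ε hε hm hεΩ
    have hε0 : 0 < ε := hε.1
    have i1 : Integrable (fun y => h y (φ (ε⁻¹ • (y - x)))) V.mass :=
      V.integrable_mass (isCompact_closedBall x ε) hεΩ (by fun_prop) fun y hy => by
        rw [notMem_closedBall_scaled hφ0 hε0 fun h => hy (Metric.ball_subset_closedBall h),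
          map_zero]
    have i2 := V.integrable_scaled hΦc hΦ0 hε0 hεΩ
    have i1' : Integrable (fun y => ε⁻¹ • h y (φ (ε⁻¹ • (y - x)))) V.mass := i1.smul ε⁻¹
    rw [← smul_sub, ← integral_smul, ← integral_sub i1' i2, norm_smul, norm_inv,
      norm_pow, Real.norm_eq_abs, abs_of_pos hε0]
    have hb : ‖∫ y, (ε⁻¹ • h y (φ (ε⁻¹ • (y - x))) -
        h' (ε⁻¹ • (y - x)) (φ (ε⁻¹ • (y - x)))) ∂V.mass‖ ≤
        δ * K * V.mass.real (Metric.closedBall x ε) := by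
      refine norm_integral_le_mul_measureReal (V.mass_closedBall_lt_top hεΩ)
        (Eventually.of_forall fun y hy => ?_) fun y hy => ?_
      · rw [mem_closedBall_iff_norm] at hy
        have hyr : y ∈ Metric.ball x r := mem_ball_iff_norm.2 (hy.trans_lt hε.2)
        have h2 := hrb y hyr
        rw [hhx, sub_zero] at h2
        have e1 : ε⁻¹ • h y (φ (ε⁻¹ • (y - x))) - h' (ε⁻¹ • (y - x)) (φ (ε⁻¹ • (y - x))) =
            ε⁻¹ • ((h y - h' (y - x)) (φ (ε⁻¹ • (y - x)))) := by
          have : h' (ε⁻¹ • (y - x)) = ε⁻¹ • h' (y - x) := map_smul _ _ _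
          rw [this, smul_apply, sub_apply, ← smul_sub]
        rw [e1, norm_smul, norm_inv, Real.norm_eq_abs, abs_of_pos hε0, inv_mul_le_iff₀ hε0]
        refine ((h y - h' (y - x)).le_opNorm _).trans ?_
        refine (mul_le_mul (h2.trans (mul_le_mul_of_nonneg_left hy hδ0.le)) (hφb _)
          (norm_nonneg _) (by positivity)).trans (le_of_eq ?_)
        ring
      · rw [notMem_closedBall_scaled hφ0 hε0 fun h => hy (Metric.ball_subset_closedBall h),
          map_zero, map_zero, smul_zero, sub_zero]
    have hm' : V.mass.real (Metric.closedBall x ε) ≤ C * ε ^ d :=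
      (measureReal_mono (Metric.closedBall_subset_closedBall (by linarith))
        (V.mass_closedBall_lt_top hm.1).ne).trans hm.2
    have hεd : 0 < ε ^ d := by positivity
    rw [inv_mul_lt_iff₀ hεd]
    refine (hb.trans (mul_le_mul_of_nonneg_left hm' (by positivity))).trans_lt ?_
    have : δ * (2 * (K * C + 1)) = e := by rw [hδ]; field_simp
    have h3 : δ * K * C < e := by
      rw [← this]
      nlinarith [mul_pos hδ0 hKC]
    calc δ * K * (C * ε ^ d) = ε ^ d * (δ * K * C) := by ring
      _ < ε ^ d * e := mul_lt_mul_of_pos_left h3 hεd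
  simpa using hdiff.add h1

/-- The projections of the canonical basis vectors onto the range of an isometry. -/
lemma starProjection_range_apply {ι : E d →ₗᵢ[ℝ] E n} {S : Submodule ℝ (E n)}
    (hS : ι.toLinearMap.range = S) (v : E n) :
    S.starProjection v = ι (ContinuousLinearMap.adjoint ι.toContinuousLinearMap v) := by
  subst hS
  refine Submodule.eq_starProjection_of_mem_of_inner_eq_zero ⟨_, rfl⟩ ?_
  rintro _ ⟨w, rfl⟩
  change inner ℝ _ (ι w) = 0
  rw [inner_sub_left, ι.inner_map_map, ContinuousLinearMap.adjoint_inner_left]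
  exact sub_self _

/-- The vectors ι*e_j form a Parseval frame of ℝ^d, since ι*ι = 1. This lets traces over T_xM be
written with the n basis vectors of ℝⁿ, as in `meanCurvature`. -/
lemma sum_inner_adjoint_smul (ι : E d →ₗᵢ[ℝ] E n) (u : E d) :
    ∑ j, inner ℝ (ContinuousLinearMap.adjoint ι.toContinuousLinearMap
      (EuclideanSpace.single j (1 : ℝ))) u •
        ContinuousLinearMap.adjoint ι.toContinuousLinearMap (EuclideanSpace.single j (1 : ℝ)) = u := by
  set A := ContinuousLinearMap.adjoint ι.toContinuousLinearMap with hA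
  have h1 : ∀ u, A (ι u) = u := fun u => by
    refine ext_inner_right ℝ fun w => ?_
    rw [hA, ContinuousLinearMap.adjoint_inner_left]
    exact ι.inner_map_map u w
  have h2 := (EuclideanSpace.basisFun (Fin n) ℝ).sum_repr' (ι u)
  have h3 := congrArg A h2
  rw [map_sum, h1] at h3
  refine Eq.trans (Finset.sum_congr rfl fun j _ => ?_) h3
  rw [map_smul, EuclideanSpace.basisFun_apply, hA, ContinuousLinearMap.adjoint_inner_left]
  rfl

/-- Integrating a bilinear form against `u ⊗ ∇ρ(|u|)` over a subspace yields its trace. -/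
lemma integral_bilinear_radialGrad (hd : 1 ≤ d) (hρ : Differentiable ℝ ρ) (h0 : deriv ρ 0 = 0)
    {K : ℝ≥0} (hK : LipschitzWith K (deriv ρ)) (hs : tsupport ρ ⊆ Icc (-1) 1)
    {ι : E d →ₗᵢ[ℝ] E n} {S : Submodule ℝ (E n)} (hS : ι.toLinearMap.range = S)
    (B : E n →L[ℝ] E n →L[ℝ] E n) :
    ∫ u, B (ι u) (radialGrad ρ (ι u)) = -(kernelConst d ρ • ∑ k,
      B (S.starProjection (EuclideanSpace.single k 1))
        (S.starProjection (EuclideanSpace.single k 1))) := by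
  have hG : Continuous (radialGrad ρ : E d → E d) :=
    continuous_of_lipschitz (K := 3 * K) (by positivity) (radialGrad_sub_le hK h0)
  have hG0 : ∀ w : E d, 1 ≤ ‖w‖ → radialGrad ρ w = 0 := fun w hw => by
    simp [radialGrad, eq_zero_of_tsupport hK.continuous (tsupport_deriv_subset_Icc hs) hw]
  simp only [starProjection_range_apply hS]
  set a : Fin n → E d := fun j =>
    ContinuousLinearMap.adjoint ι.toContinuousLinearMap (EuclideanSpace.single j 1) with ha
  have hfr : ∀ u, ∑ j, inner ℝ (a j) u • a j = u := sum_inner_adjoint_smul ι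
  -- Both arguments are expanded in the Parseval frame. Integration by parts then yields ⟨a_j, a_k⟩,
  -- and the sum over j collapses to a_k.
  have e1 : ∀ u : E d, B (ι u) (radialGrad ρ (ι u)) =
      ∑ k, ∑ j, (inner ℝ (a j) u * inner ℝ (a k) (radialGrad ρ u)) • B (ι (a j)) (ι (a k)) := by
    intro u
    have hGι : radialGrad ρ (ι u) = ι (radialGrad ρ u) := by
      simp [radialGrad]
    rw [hGι]
    calc B (ι u) (ι (radialGrad ρ u))
        = B (ι (∑ j, inner ℝ (a j) u • a j))
            (ι (∑ k, inner ℝ (a k) (radialGrad ρ u) • a k)) := by rw [hfr, hfr]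
      _ = _ := by
        simp only [map_sum, map_smul, sum_apply, smul_apply, Finset.smul_sum, smul_smul, mul_comm]
  have hint : ∀ k j, Integrable fun u : E d =>
      (inner ℝ (a j) u * inner ℝ (a k) (radialGrad ρ u)) • B (ι (a j)) (ι (a k)) := fun k j =>
    (by fun_prop : Continuous fun u : E d =>
      (inner ℝ (a j) u * inner ℝ (a k) (radialGrad ρ u)) • B (ι (a j)) (ι (a k)))
      |>.integrable_of_hasCompactSupport
      (hasCompactSupport_comp_norm fun w hw => by simp [hG0 w hw])
  simp only [e1]
  rw [integral_finsetSum _ fun k _ => integrable_finsetSum _ fun j _ => hint k j,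
    Finset.smul_sum, ← Finset.sum_neg_distrib]
  refine Finset.sum_congr rfl fun k _ => ?_
  rw [integral_finsetSum _ fun j _ => hint k j]
  have e2 : ∀ j, ∫ u : E d, (inner ℝ (a j) u * inner ℝ (a k) (radialGrad ρ u)) •
      B (ι (a j)) (ι (a k)) =
      -(kernelConst d ρ • B (ι (inner ℝ (a j) (a k) • a j)) (ι (a k))) := fun j => by
    rw [integral_smul_const, integral_inner_mul_inner_radialGrad hρ h0 hK hs,
      integral_comp_norm (F := E d) hd finrank_euclideanSpace_fin
        fun t ht => eq_zero_of_tsupport hρ.continuous hs ht,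
      map_smul, map_smul, smul_apply, smul_smul, neg_smul, mul_comm]
  simp only [e2]
  rw [Finset.sum_neg_distrib, ← Finset.smul_sum, ← sum_apply, ← map_sum, ← map_sum, hfr]

/-- A derivative within M need not be unique as a linear map on ℝⁿ. Along a curve in M, however, any
such derivative must give the derivative of the composition, so all agree on velocities and hence on
their span. -/
lemma fderivWithin_tangentProj_apply {T : E n → (E n →L[ℝ] E n)}
    {T' : E n →L[ℝ] (E n →L[ℝ] E n)} (hx : x ∈ M) (hTM : ∀ y ∈ M, T y = tangentProj M y)
    (hT : HasFDerivAt T T' x) {v : E n} (hv : v ∈ tangentSpace M x) :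
    fderivWithin ℝ (tangentProj M) M x v = T' v := by
  have h1 : HasFDerivWithinAt (tangentProj M) T' M x :=
    hT.hasFDerivWithinAt.congr (fun y hy => (hTM y hy).symm) (hTM x hx).symm
  have h2 := h1.differentiableWithinAt.hasFDerivWithinAt
  induction hv using Submodule.span_induction with
  | mem v hv =>
    obtain ⟨γ, hγ0, hγM, hγ⟩ := hv
    exact (h2.comp_hasDerivAt_of_eq 0 hγ hγM hγ0.symm).unique
      (h1.comp_hasDerivAt_of_eq 0 hγ hγM hγ0.symm)
  | zero => simp
  | add u v _ _ hu hv => rw [map_add, map_add, hu, hv]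
  | smul c v _ hv => rw [map_smul, map_smul, hv]

/-- The derivative of a field of projections maps vectors of the range to normal vectors. -/
lemma apply_fderiv_projection_eq_zero {T : E n → (E n →L[ℝ] E n)}
    {T' : E n →L[ℝ] (E n →L[ℝ] E n)} (hT : HasFDerivAt T T' x)
    (hTi : ∀ᶠ y in 𝓝 x, IsIdempotentElem (T y)) {v : E n} (hv : T x v = v) (u : E n) :
    T x (T' u v) = 0 := by
  have h1 : HasFDerivAt (fun y => T y (T y v))
      (T'.flip (T x v) + (T x).comp (T'.flip v)) x := by
    have h2 : HasFDerivAt (fun y => T y v) (T'.flip v) x := by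
      refine (hT.clm_apply (hasFDerivAt_const v x)).congr_fderiv ?_
      ext w
      simp
    refine (hT.clm_apply h2).congr_fderiv ?_
    ext w
    simp [add_comm]
  have h3 : HasFDerivAt (fun y => T y (T y v)) (T'.flip v) x := by
    have h2 : HasFDerivAt (fun y => T y v) (T'.flip v) x := by
      refine (hT.clm_apply (hasFDerivAt_const v x)).congr_fderiv ?_
      ext w
      simp
    refine h2.congr_of_eventuallyEq ?_
    filter_upwards [hTi] with y hy
    exact congrArg (fun A : E n →L[ℝ] E n => A v) hy.eq
  have h4 := congrArg (fun A : E n →L[ℝ] E n => A u) (h1.unique h3)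
  simpa [hv] using h4

lemma sum_normal_fderiv_eq_meanCurvature {T : E n → (E n →L[ℝ] E n)}
    {T' : E n →L[ℝ] (E n →L[ℝ] E n)} (hx : x ∈ M) (hTM : ∀ y ∈ M, T y = tangentProj M y)
    (hT : HasFDerivAt T T' x) (hTi : ∀ᶠ y in 𝓝 x, IsIdempotentElem (T y)) :
    ∑ k, (ContinuousLinearMap.id ℝ (E n) - tangentProj M x)
      (T' (tangentProj M x (EuclideanSpace.single k 1))
        (tangentProj M x (EuclideanSpace.single k 1))) = meanCurvature M x := by
  refine Finset.sum_congr rfl fun k _ => ?_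
  have hmem : tangentProj M x (EuclideanSpace.single k 1) ∈ tangentSpace M x :=
    Submodule.starProjection_apply_mem _ _
  rw [fderivWithin_tangentProj_apply hx hTM hT hmem, sub_apply, ← hTM x hx,
    apply_fderiv_projection_eq_zero hT hTi, sub_zero, ContinuousLinearMap.id_apply]
  rw [hTM x hx]
  exact Submodule.starProjection_eq_self_iff.2 hmem

end Limits

/-! ### Stability of the orthogonal approximate mean curvature at one scale -/

section Estimate

variable {d n : ℕ} {Ω : Set (E n)} {V W : Varifold d n Ω} {x z : E n} {ρ ξ : ℝ → ℝ}

/-- The cone test yields ε times the mass up to the error δCε^d. The condition δ ≤ ε makes this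
error no larger than the main term, whence the factor 2. -/
lemma mass_le_of_close (hΩ : IsOpen Ω) {ε δ C : ℝ} (hε : 0 < ε) (hε1 : ε ≤ 1) (hC : 0 ≤ C)
    (hδ : 0 ≤ δ) (hδε : δ ≤ ε) (hεΩ : Metric.closedBall x (5 * ε) ⊆ Ω)
    (hm : V.mass.real (Metric.closedBall x (5 * ε)) ≤ C * ε ^ d)
    (hΔ : boundedLipschitzDist Ω (Metric.ball x (4 * ε)) V.mass W.mass ≤
      ENNReal.ofReal (δ * (C * ε ^ d))) :
    W.mass.real (Metric.closedBall x (2 * ε)) ≤ 2 * (C * ε ^ d) := by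
  have hCe : 0 ≤ C * ε ^ d := by positivity
  have h1 := measureReal_closedBall_le hΩ hε hε1 (mul_nonneg hδ hCe)
    ((Metric.closedBall_subset_closedBall (by linarith)).trans hεΩ) hΔ
    ((measureReal_mono (Metric.closedBall_subset_closedBall (by linarith))
      (V.mass_closedBall_lt_top hεΩ).ne).trans hm)
  have h2 := mul_le_mul_of_nonneg_right hδε hCe
  exact le_of_mul_le_mul_left (by linarith) hε

lemma abs_kernelMass_sub_le (hΩ : IsOpen Ω) {ε δ C L : ℝ} (hε : 0 < ε) (hε1 : ε ≤ 1) (hC : 0 ≤ C)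
    (hδ : 0 ≤ δ) (hδε : δ ≤ ε) (hz : ‖x - z‖ ≤ ε) (hεΩ : Metric.closedBall x (5 * ε) ⊆ Ω)
    (hm : V.mass.real (Metric.closedBall x (5 * ε)) ≤ C * ε ^ d)
    (hΔ : boundedLipschitzDist Ω (Metric.ball x (4 * ε)) V.mass W.mass ≤
      ENNReal.ofReal (δ * (C * ε ^ d)))
    (hL : 0 < L) (hξl : ∀ s t, |ξ s - ξ t| ≤ L * |s - t|) (hξb : ∀ t, 0 ≤ t → |ξ t| ≤ L)
    (hξ0 : ∀ t, 1 ≤ t → ξ t = 0) :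
    |kernelMass W ξ ε z - kernelMass V ξ ε x| ≤
      2 * L * C * ε⁻¹ * ε ^ d * (δ + ‖x - z‖) := by
  have hCe : 0 ≤ C * ε ^ d := by positivity
  have h1 := abs_integral_scaled_sub_le hΩ hε hε1 hz
    ((Metric.closedBall_subset_closedBall (by linarith)).trans hεΩ) (mul_nonneg hδ hCe) hΔ
    (mass_le_of_close hΩ hε hε1 hC hδ hδε hεΩ hm hΔ) hL (φ := fun w => ξ ‖w‖)
    (fun u v => (hξl _ _).trans (mul_le_mul_of_nonneg_left (abs_norm_sub_norm_le u v) hL.le))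
    (fun u => hξb _ (norm_nonneg _)) (fun w hw => hξ0 _ hw)
  refine h1.trans ?_
  have h2 : 0 ≤ L * ε⁻¹ * (δ * (C * ε ^ d)) := by positivity
  have e : 2 * L * C * ε⁻¹ * ε ^ d * (δ + ‖x - z‖) =
    L * ε⁻¹ * (‖x - z‖ * (2 * (C * ε ^ d)) + δ * (C * ε ^ d)) + L * ε⁻¹ * (δ * (C * ε ^ d)) := by
    ring
  linarith

/-- Perturbation of a quotient. In the application A carries a factor 1/ε, which is offset by a
factor ε in Y. -/
lemma norm_inv_smul_sub_le {F : Type*} [NormedAddCommGroup F] [NormedSpace ℝ F] {α α' a : ℝ}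
    (ha : 0 < a) (hα : a ≤ α) (hα' : a ≤ α') {q q' : F} {A X Y : ℝ} (hA : |α' - α| ≤ A)
    (hX : ‖q' - q‖ ≤ X) (hY : ‖q‖ ≤ Y) :
    ‖α'⁻¹ • q' - α⁻¹ • q‖ ≤ a⁻¹ * X + a⁻¹ * a⁻¹ * A * Y := by
  have h0 : 0 < α := ha.trans_le hα
  have h0' : 0 < α' := ha.trans_le hα'
  have e : α'⁻¹ • q' - α⁻¹ • q = α'⁻¹ • (q' - q) + (α'⁻¹ * α⁻¹ * (α - α')) • q := by
    have : α'⁻¹ * α⁻¹ * (α - α') = α'⁻¹ - α⁻¹ := by field_simp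
    rw [this, smul_sub, sub_smul]
    abel
  have i : α⁻¹ ≤ a⁻¹ := inv_anti₀ ha hα
  have i' : α'⁻¹ ≤ a⁻¹ := inv_anti₀ ha hα'
  rw [e]
  refine (norm_add_le _ _).trans (add_le_add ?_ ?_)
  · rw [norm_smul, Real.norm_eq_abs, abs_of_pos (inv_pos.2 h0')]
    exact mul_le_mul i' hX (norm_nonneg _) (inv_pos.2 ha).le
  · rw [norm_smul, Real.norm_eq_abs, abs_mul, abs_mul, abs_of_pos (inv_pos.2 h0'),
      abs_of_pos (inv_pos.2 h0), abs_sub_comm]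
    have hA0 : 0 ≤ A := (abs_nonneg _).trans hA
    gcongr

set_option maxHeartbeats 1000000 in
/-- Quantitative stability of the orthogonal approximate mean curvature at a fixed scale. -/
theorem norm_orthApproxMeanCurvature_sub_le (hΩ : IsOpen Ω)
    {ν : ProbabilityTheory.Kernel (E n) (E n →L[ℝ] E n)} (hν : IsYoungMeasure W ν)
    (hρ : Differentiable ℝ ρ) (h0 : deriv ρ 0 = 0) {ε δ δ₂ C L L' κ a : ℝ} (hε : 0 < ε)
    (hε1 : ε ≤ 1) (hC : 0 ≤ C) (hδ : 0 ≤ δ) (hδε : δ ≤ ε) (hδ₂ : 0 ≤ δ₂) (hz : ‖x - z‖ ≤ ε)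
    (hεΩ : Metric.closedBall x (5 * ε) ⊆ Ω)
    (hm : V.mass.real (Metric.closedBall x (5 * ε)) ≤ C * ε ^ d)
    (hΔ : boundedLipschitzDist Ω (Metric.ball x (4 * ε)) V.mass W.mass ≤
      ENNReal.ofReal (δ * (C * ε ^ d)))
    (hL : 0 < L) (hξl : ∀ s t, |ξ s - ξ t| ≤ L * |s - t|) (hξb : ∀ t, 0 ≤ t → |ξ t| ≤ L)
    (hξ0 : ∀ t, 1 ≤ t → ξ t = 0)
    (hL' : 0 < L') (hGl : ∀ u v : E n, ‖radialGrad ρ u - radialGrad ρ v‖ ≤ L' * ‖u - v‖)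
    (hGb : ∀ u : E n, ‖radialGrad ρ u‖ ≤ L') (hG0 : ∀ w : E n, 1 ≤ ‖w‖ → radialGrad ρ w = 0)
    {T : E n → (E n →L[ℝ] E n)} (hκ : 0 < κ) (hTl : ∀ y y', ‖T y - T y'‖ ≤ κ * ‖y - y'‖)
    {P : E n →L[ℝ] E n} (hTx : T x = P) (hP : IsStarProjection P)
    (hTν : ∀ᵐ y ∂W.mass, y ∈ Metric.ball z ε → ∫ S, ‖T y - S‖ ∂(ν y) ≤ δ₂)
    (hTνz : ∫ S, ‖T z - S‖ ∂(ν z) ≤ δ₂)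
    (hβ : (1 - P) (kernelVariation V ρ ε x) =
      ∫ y, ((1 - P) * (T y - P)) (radialGrad ρ (ε⁻¹ • (y - x))) ∂V.mass)
    (hc : 0 ≤ kernelConst d ξ / kernelConst d ρ)
    (ha : 0 < a) (hα : a * ε ^ d ≤ kernelMass V ξ ε x) (hα' : a * ε ^ d ≤ kernelMass W ξ ε z) :
    ‖orthApproxMeanCurvature W ν ρ ξ ε z -
      (approxMeanCurvature V ρ ξ ε x - P (approxMeanCurvature V ρ ξ ε x))‖ ≤
      kernelConst d ξ / kernelConst d ρ * (2 * (1 + κ) * L' * C * a⁻¹ +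
        (a⁻¹ * ((2 * L' + 4 * κ * L') * C) + 10 * a⁻¹ * a⁻¹ * L * κ * L' * C * C)) *
        ((δ + δ₂ + ‖x - z‖) / ε) := by
  have := hν.isMarkov
  set c := kernelConst d ξ / kernelConst d ρ with hcdef
  set e := ε ^ d with he
  have he0 : 0 < e := by positivity
  set s := δ + δ₂ + ‖x - z‖ with hs
  have hs0 : 0 ≤ s := by positivity
  set Q : E n →L[ℝ] E n := 1 - P with hQ
  have hQ1 : ‖Q‖ ≤ 1 := hP.one_sub.norm_le
  have hQP : Q * P = 0 := by rw [hQ, sub_mul, one_mul, hP.isIdempotentElem.eq, sub_self]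
  let h : E n → (E n →L[ℝ] E n) := fun y => Q * (T y - P)
  have hhl : ∀ y y', ‖h y - h y'‖ ≤ κ * ‖y - y'‖ := fun y y' => by
    have : h y - h y' = Q * (T y - T y') := by
      simp only [h]
      rw [← mul_sub, sub_sub_sub_cancel_right]
    rw [this]
    refine (norm_mul_le _ _).trans ((mul_le_mul hQ1 (hTl y y') (norm_nonneg _)
      zero_le_one).trans (one_mul _).le)
  have hhx : h x = 0 := by simp [h, hTx]
  have hhb : ∀ y, ‖h y‖ ≤ κ * ‖y - x‖ := fun y => by simpa [hhx] using hhl y x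
  have hTc : Continuous T := continuous_of_lipschitz hκ.le hTl
  have hhc : Continuous h := continuous_of_lipschitz hκ.le hhl
  have hGc : Continuous (radialGrad ρ : E n → E n) := continuous_of_lipschitz hL'.le hGl
  have h2Ω : Metric.closedBall x (2 * ε) ⊆ Ω :=
    (Metric.closedBall_subset_closedBall (by linarith)).trans hεΩ
  have h1Ω : Metric.closedBall x ε ⊆ Ω :=
    (Metric.closedBall_subset_closedBall (by linarith)).trans hεΩ
  have hCe : 0 ≤ C * e := by positivity
  have hB := mass_le_of_close hΩ hε hε1 hC hδ hδε hεΩ hm hΔ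
  set α := kernelMass V ξ ε x with hαd
  set α' := kernelMass W ξ ε z with hαd'
  set β := kernelVariation V ρ ε x with hβd
  set β' := kernelVariation W ρ ε z with hβd'
  have hδs : δ + ‖x - z‖ ≤ s := by rw [hs]; linarith
  have E1 : |α' - α| ≤ 2 * L * C * ε⁻¹ * e * s :=
    (abs_kernelMass_sub_le hΩ hε hε1 hC hδ hδε hz hεΩ hm hΔ hL hξl hξb hξ0).trans
      (mul_le_mul_of_nonneg_left hδs (by positivity))
  -- Three moves: S is replaced by T under W, the centre moves from z to x, and ‖W‖ is exchanged for
  -- ‖V‖. The last two use h = QT, which vanishes at x.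
  have E2 : ‖Q β' - Q β‖ ≤ (2 * L' + 4 * κ * L') * C * e * s := by
    have s1 := norm_integral_apply_sub_le hν hε hz h2Ω hB hL'.le hδ₂ hTc hTν hQ1 hGc hGb hG0
    have s2 := norm_integral_shift_le hε hz h2Ω hB hhc hL'.le hκ.le hhb hGl hG0
    have s3 := norm_integral_clm_scaled_sub_le hΩ hε hε1 h1Ω (mul_nonneg hδ hCe) hΔ hL' hκ hhl hhx
      hGl hGb hG0
    have e1 : ∀ y v, h y v = Q (T y v) := fun y v => by
      have : h y = Q * T y := by simp only [h]; rw [mul_sub, hQP, sub_zero]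
      rw [this]
      rfl
    simp only [← e1] at s1
    rw [hβ]
    rw [norm_sub_rev] at s3
    have s4 := norm_sub_le_norm_sub_add_norm_sub (Q β')
      (∫ y, h y (radialGrad ρ (ε⁻¹ • (y - z))) ∂W.mass)
      (∫ y, h y (radialGrad ρ (ε⁻¹ • (y - x))) ∂V.mass)
    have s5 := norm_sub_le_norm_sub_add_norm_sub
      (∫ y, h y (radialGrad ρ (ε⁻¹ • (y - z))) ∂W.mass)
      (∫ y, h y (radialGrad ρ (ε⁻¹ • (y - x))) ∂W.mass)
      (∫ y, h y (radialGrad ρ (ε⁻¹ • (y - x))) ∂V.mass)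
    have p1 : 0 ≤ L' * C * e * δ := by positivity
    have p2 : 0 ≤ κ * L' * C * e * δ := by positivity
    have p3 : 0 ≤ κ * L' * C * e * δ₂ := by positivity
    have p4 : 0 ≤ L' * C * e * ‖x - z‖ := by positivity
    rw [hs]
    refine (s4.trans (add_le_add s1 (s5.trans (add_le_add s2 s3)))).trans ?_
    have e2 : (2 * L' + 4 * κ * L') * C * e * (δ + δ₂ + ‖x - z‖) =
        L' * δ₂ * (2 * (C * e)) + (2 * κ * L' * ‖x - z‖ * (2 * (C * e)) +
          2 * κ * L' * (δ * (C * e))) + (2 * (L' * C * e * δ) + 2 * (κ * L' * C * e * δ) +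
          4 * (κ * L' * C * e * δ₂) + 2 * (L' * C * e * ‖x - z‖)) := by ring
    rw [e2]
    linarith
  have E3 : ‖Q β‖ ≤ κ * (5 * ε) * L' * (C * e) := by
    rw [hβ]
    refine (norm_integral_le_mul_measureReal (c := κ * (5 * ε) * L')
      (V.mass_closedBall_lt_top hεΩ) (Eventually.of_forall fun y hy => ?_) fun y hy => ?_).trans
      (mul_le_mul_of_nonneg_left hm (by positivity))
    · rw [mem_closedBall_iff_norm] at hy
      exact ((h y).le_opNorm _).trans (mul_le_mul ((hhb y).trans
        (mul_le_mul_of_nonneg_left hy hκ.le)) (hGb _) (norm_nonneg _) (by positivity))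
    · rw [notMem_closedBall_scaled hG0 hε fun h => hy (Metric.closedBall_subset_closedBall
        (by linarith) (Metric.ball_subset_closedBall h)), map_zero]
  have E4 : ‖β'‖ ≤ L' * (2 * (C * e)) := norm_integral_apply_le hε hz h2Ω hB hL'.le hGb hG0
  have hae : 0 < a * e := by positivity
  have hα'0 : 0 < α' := hae.trans_le hα'
  set v' := approxMeanCurvature W ρ ξ ε z with hv'
  set v := approxMeanCurvature V ρ ξ ε x with hv
  have ev' : v' = -((c * α'⁻¹ * ε⁻¹) • β') := approxMeanCurvature_eq W hρ h0 ξ hε z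
  have ev : v = -((c * α⁻¹ * ε⁻¹) • β) := approxMeanCurvature_eq V hρ h0 ξ hε x
  -- Without the normal projection there is no cancellation; the bound 1/ε suffices because E6
  -- multiplies it by a change of projection of size O(s).
  have E5 : ‖v'‖ ≤ c * (2 * L' * C * a⁻¹) * ε⁻¹ := by
    rw [ev', norm_neg, norm_smul, Real.norm_eq_abs, abs_of_nonneg (by positivity)]
    have i' : α'⁻¹ ≤ (a * e)⁻¹ := inv_anti₀ hae hα'
    calc c * α'⁻¹ * ε⁻¹ * ‖β'‖ ≤ c * (a * e)⁻¹ * ε⁻¹ * (L' * (2 * (C * e))) := by gcongr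
      _ = c * (2 * L' * C * a⁻¹) * ε⁻¹ := by field_simp
  have E6 : ‖orthApproxMeanCurvature W ν ρ ξ ε z - (v' - P v')‖ ≤
      (1 + κ) * s * (c * (2 * L' * C * a⁻¹) * ε⁻¹) := by
    have hTz : ‖T z - P‖ ≤ κ * ‖x - z‖ := by
      rw [← hTx, norm_sub_rev x]
      exact hTl z x
    refine (norm_orthogonal_average_sub_le (hν.carried z) hTνz hTz v').trans ?_
    refine mul_le_mul ?_ E5 (norm_nonneg _) (by positivity)
    have p1 : 0 ≤ κ * δ := by positivity
    have p2 : 0 ≤ κ * δ₂ := by positivity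
    have e1 : (1 + κ) * s = δ₂ + κ * ‖x - z‖ + (δ + ‖x - z‖ + κ * δ + κ * δ₂) := by
      rw [hs]; ring
    rw [e1]
    linarith [norm_nonneg (x - z)]
  have E7 : ‖(v' - P v') - (v - P v)‖ ≤
      c * ε⁻¹ * (a⁻¹ * ((2 * L' + 4 * κ * L') * C) + 10 * a⁻¹ * a⁻¹ * L * κ * L' * C * C) * s := by
    have eQ : ∀ w, w - P w = Q w := fun w => by simp [hQ]
    have e1 : Q v' - Q v = -((c * ε⁻¹) • (α'⁻¹ • Q β' - α⁻¹ • Q β)) := by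
      rw [ev', ev, map_neg, map_neg, map_smul, map_smul, smul_sub, smul_smul, smul_smul,
        mul_right_comm c α'⁻¹, mul_right_comm c α⁻¹]
      abel
    rw [eQ, eQ, e1, norm_neg, norm_smul, Real.norm_eq_abs,
      abs_of_nonneg (by positivity : 0 ≤ c * ε⁻¹), mul_assoc (c * ε⁻¹)]
    refine mul_le_mul_of_nonneg_left ?_ (by positivity)
    refine (norm_inv_smul_sub_le hae hα hα' E1 E2 E3).trans (le_of_eq ?_)
    field_simp
    ring
  refine (norm_sub_le_norm_sub_add_norm_sub _ (v' - P v') _).trans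
    ((add_le_add E6 E7).trans (le_of_eq ?_))
  field_simp

end Estimate

/-! ### Convergence for the submanifold itself -/

section Assembly

variable {d n : ℕ} {Ω : Set (E n)} {V : Varifold d n Ω} {M : Set (E n)} {x : E n} {ρ ξ : ℝ → ℝ}

lemma orthApproxMeanCurvature_dirac (V : Varifold d n Ω) (A : E n → (E n →L[ℝ] E n)) (ρ ξ : ℝ → ℝ)
    (ε : ℝ) (x : E n) :
    orthApproxMeanCurvature V (fun y => Measure.dirac (A y)) ρ ξ ε x =
      approxMeanCurvature V ρ ξ ε x - A x (approxMeanCurvature V ρ ξ ε x) := by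
  rw [orthApproxMeanCurvature, integral_dirac]

/-- The normal part of the first variation of `v(M, 1)`, written with a field extending the tangent
projections near `x`. -/
lemma normal_kernelVariation_eq (hV : IsUnitDensityVarifold V M) (hM : MeasurableSet M)
    (hm : AEMeasurable (fun y => (y, tangentProj M y)) ((μHE[d] : Measure (E n)).restrict M))
    {P : E n →L[ℝ] E n} (hP : IsIdempotentElem P) {T : E n → (E n →L[ℝ] E n)} {r : ℝ}
    (hTM : ∀ y ∈ M, y ∈ Metric.ball x r → T y = tangentProj M y)
    (hGc : Continuous (radialGrad ρ : E n → E n)) {K : ℝ} (hGb : ∀ u : E n, ‖radialGrad ρ u‖ ≤ K)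
    (hG0 : ∀ w : E n, 1 ≤ ‖w‖ → radialGrad ρ w = 0) {ε : ℝ} (hε : 0 < ε) (hεr : ε ≤ r)
    (hεΩ : Metric.closedBall x (2 * ε) ⊆ Ω) :
    (1 - P) (kernelVariation V ρ ε x) =
      ∫ y, ((1 - P) * (T y - P)) (radialGrad ρ (ε⁻¹ • (y - x))) ∂V.mass := by
  have i := integrable_apply (W := V) (z := x) hε (by simpa using hε.le) hεΩ hGc hGb hG0
  rw [kernelVariation, ← (1 - P : E n →L[ℝ] E n).integral_comp_comm i, hV.mass_eq hm]
  have hc : Continuous fun p : E n × (E n →L[ℝ] E n) =>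
      (1 - P : E n →L[ℝ] E n) (p.2 (radialGrad ρ (ε⁻¹ • (p.1 - x)))) := by fun_prop
  have e := integral_map hm (f := fun p : E n × (E n →L[ℝ] E n) =>
      (1 - P : E n →L[ℝ] E n) (p.2 (radialGrad ρ (ε⁻¹ • (p.1 - x))))) hc.aestronglyMeasurable
  rw [hV, e]
  refine integral_congr_ae ?_
  filter_upwards [ae_restrict_mem hM] with y hy
  by_cases hyb : y ∈ Metric.ball x ε
  -- Since (1 - P)P = 0, subtracting P is free; it exhibits the factor vanishing at x.
  · have e1 : (1 - P) * (T y - P) = (1 - P) * T y := by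
      rw [mul_sub (1 - P), sub_mul 1 P P, one_mul, hP.eq, sub_self, sub_zero]
    rw [e1, hTM y hy (Metric.ball_subset_ball hεr hyb)]
    rfl
  · rw [notMem_closedBall_scaled hG0 hε hyb, map_zero, map_zero, map_zero]

/-- Needed because the closeness of the masses is assumed only on balls centred in the support of
‖V‖, and the balls used are centred at x. -/
lemma mem_supp_of_kernelMass_pos {K : ℝ} (hξb : ∀ t, 0 ≤ t → |ξ t| ≤ K)
    (hξ0 : ∀ t, 1 ≤ t → ξ t = 0) (hx : x ∈ Ω)
    (hpos : ∀ᶠ ε : ℝ in 𝓝[>] 0, 0 < kernelMass V ξ ε x) : x ∈ V.supp := by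
  refine ⟨?_, hx⟩
  by_contra h
  obtain ⟨U, hU, hU0⟩ := Measure.notMem_support_iff_exists.1 h
  obtain ⟨r, hr, hrU⟩ := Metric.mem_nhds_iff.1 hU
  have hev : ∀ᶠ ε : ℝ in 𝓝[>] 0, ε ∈ Ioo 0 r := Ioo_mem_nhdsGT hr
  obtain ⟨ε, ⟨hε, hεr⟩, hp⟩ := (hev.and hpos).exists
  have h0 : V.mass (Metric.ball x ε) = 0 :=
    measure_mono_null ((Metric.ball_subset_ball hεr.le).trans hrU) hU0
  have h1 := norm_integral_le_mul_measureReal (μ := V.mass) (s := Metric.ball x ε)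
    (f := fun y => ξ ‖ε⁻¹ • (y - x)‖) (c := K) (by rw [h0]; exact ENNReal.zero_lt_top)
    (Eventually.of_forall fun y _ => hξb _ (norm_nonneg _))
    fun y hy => notMem_closedBall_scaled (φ := fun w : E n => ξ ‖w‖) (fun w hw => hξ0 _ hw) hε hy
  rw [measureReal_def, h0, ENNReal.toReal_zero, mul_zero] at h1
  exact hp.ne' (norm_le_zero_iff.1 h1)

/-- A field of projections which is `C¹` near `x` agrees near `x` with a Lipschitz field. -/
lemma exists_lipschitz_extension {N : Set (E n)} (hN : IsOpen N) (hx : x ∈ N)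
    {T : E n → (E n →L[ℝ] E n)} (hT : ContDiffOn ℝ 1 T N) :
    ∃ (κ : ℝ) (T₀ : E n → (E n →L[ℝ] E n)), 0 < κ ∧ (∀ y y', ‖T₀ y - T₀ y'‖ ≤ κ * ‖y - y'‖) ∧
      ∀ᶠ y in 𝓝 x, T₀ y = T y := by
  obtain ⟨K, t, ht, hK⟩ := (hT.contDiffAt (hN.mem_nhds hx)).exists_lipschitzOnWith
  obtain ⟨T₀, hT₀, he⟩ := hK.extend_finite_dimension
  -- The extended field need not consist of projections away from x; one is added to the constant to
  -- make it strictly positive.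
  set κ₀ := lipschitzExtensionConstant (E n →L[ℝ] E n) * K
  refine ⟨κ₀ + 1, T₀, by positivity, fun y y' => ?_, ?_⟩
  · have := hT₀.dist_le_mul y y'
    rw [dist_eq_norm, dist_eq_norm] at this
    nlinarith [norm_nonneg (y - y')]
  · filter_upwards [ht] with y hy using (he hy).symm

/-- The orthogonal approximate mean curvature of a `C²` submanifold converges to its mean
curvature. -/
theorem tendsto_orthApproxMeanCurvature (hΩ : IsOpen Ω) (hd : 1 ≤ d) (hx : x ∈ M) (hxΩ : x ∈ Ω)
    {ι : E d →ₗᵢ[ℝ] E n} (hιr : ι.toLinearMap.range = tangentSpace M x)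
    (hι : ∀ φ : E n → ℝ, Continuous φ → (∀ w, 1 ≤ ‖w‖ → φ w = 0) →
      Tendsto (fun ε : ℝ => (ε ^ d)⁻¹ * ∫ y, φ (ε⁻¹ • (y - x)) ∂V.mass) (𝓝[>] 0)
        (𝓝 (∫ u, φ (ι u))))
    (hρ : Differentiable ℝ ρ) (h0 : deriv ρ 0 = 0) {K : ℝ≥0} (hK : LipschitzWith K (deriv ρ))
    (hs : tsupport ρ ⊆ Icc (-1) 1) {K' : ℝ≥0} (hξl : LipschitzWith K' ξ)
    (hξs : tsupport ξ ⊆ Icc (-1) 1) (hCρ : 0 < kernelConst d ρ) (hCξ : 0 < kernelConst d ξ)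
    {T : E n → (E n →L[ℝ] E n)} (hTc : Continuous T)
    (hTM : ∀ᶠ y in 𝓝 x, y ∈ M → T y = tangentProj M y)
    {T' : E n →L[ℝ] (E n →L[ℝ] E n)} (hT : HasFDerivAt T T' x)
    (hcurv : ∑ k, (ContinuousLinearMap.id ℝ (E n) - tangentProj M x)
      (T' (tangentProj M x (EuclideanSpace.single k 1))
        (tangentProj M x (EuclideanSpace.single k 1))) = meanCurvature M x)
    (hβ : ∀ᶠ ε : ℝ in 𝓝[>] 0, (1 - tangentProj M x) (kernelVariation V ρ ε x) =
      ∫ y, ((1 - tangentProj M x) * (T y - tangentProj M x)) (radialGrad ρ (ε⁻¹ • (y - x)))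
        ∂V.mass) :
    Tendsto (fun ε => orthApproxMeanCurvature V (fun y => Measure.dirac (tangentProj M y)) ρ ξ ε x)
      (𝓝[>] 0) (𝓝 (meanCurvature M x)) := by
  set P := tangentProj M x with hP
  have hTx : T x = P := hTM.self_of_nhds hx
  let h : E n → (E n →L[ℝ] E n) := fun y => (1 - P) * (T y - P)
  let h' : E n →L[ℝ] (E n →L[ℝ] E n) :=
    (ContinuousLinearMap.compL ℝ (E n) (E n) (E n) (1 - P)).comp T'
  have hh' : HasFDerivAt h h' x :=
    (ContinuousLinearMap.compL ℝ (E n) (E n) (E n) (1 - P)).hasFDerivAt.comp x (hT.sub_const P)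
  have hhc : Continuous h := continuous_const.mul (hTc.sub continuous_const)
  have hGc : Continuous (radialGrad ρ : E n → E n) :=
    continuous_of_lipschitz (K := 3 * K) (by positivity) (radialGrad_sub_le hK h0)
  have hG0 : ∀ w : E n, 1 ≤ ‖w‖ → radialGrad ρ w = 0 := fun w hw => by
    simp [radialGrad, eq_zero_of_tsupport hK.continuous (tsupport_deriv_subset_Icc hs) hw]
  have hGb : ∀ u : E n, ‖radialGrad ρ u‖ ≤ K := fun u => by
    rw [norm_radialGrad u h0]
    exact abs_le_of_lipschitz_of_tsupport hK (tsupport_deriv_subset_Icc hs) (norm_nonneg _)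
  have l1 := tendsto_normalVariation hΩ hxΩ hι hhc (by simp [h, hTx]) hh' hGc K.2 hGb hG0
  rw [integral_bilinear_radialGrad hd hρ h0 hK hs hιr h'] at l1
  have l2 := tendsto_kernelMass (V := V) (x := x) hd hξl hξs hι
  have l3 := (((l2.inv₀ hCξ.ne').const_mul (kernelConst d ξ / kernelConst d ρ)).smul l1).neg
  have e1 : -((kernelConst d ξ / kernelConst d ρ * (kernelConst d ξ)⁻¹) •
      -(kernelConst d ρ • ∑ k, h' ((tangentSpace M x).starProjection (EuclideanSpace.single k 1))
        ((tangentSpace M x).starProjection (EuclideanSpace.single k 1)))) = meanCurvature M x := by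
    rw [smul_neg, neg_neg, smul_smul]
    have : kernelConst d ξ / kernelConst d ρ * (kernelConst d ξ)⁻¹ * kernelConst d ρ = 1 := by
      field_simp
    rw [this, one_smul, ← hcurv]
    rfl
  rw [e1] at l3
  refine l3.congr' ?_
  filter_upwards [hβ, self_mem_nhdsWithin] with ε hε hε0
  have hε0' : 0 < ε := hε0
  rw [orthApproxMeanCurvature_dirac, approxMeanCurvature_eq V hρ h0 ξ hε0' x]
  change _ = _ - P _
  have eQ : ∀ w : E n, w - P w = (1 - P) w := fun w => by simp
  rw [eQ, map_neg, map_smul, hε, smul_smul, smul_smul]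
  congr 2
  have : ε ^ d ≠ 0 := by positivity
  rw [mul_inv, inv_inv]
  field_simp

end Assembly

end VarifoldCurvature

end
-- The main theorem
open VarifoldCurvature in
theorem theorem4p7 {d n : ℕ} (hd : 1 ≤ d) (hdn : d < n)
    (Ω : Set (E n)) (hΩ : IsOpen Ω)
    -- the submanifold `M` and the varifold `V = v(M, 1)`
    (M : Set (E n)) (hMΩ : M ⊆ Ω) (hM : IsC2Submanifold d M)
    (V : Varifold d n Ω) (hV : IsUnitDensityVarifold V M)
    -- a `C¹` extension `T` of `y ↦ T_yM` to a neighbourhood `N` of `M`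
    (N : Set (E n)) (hN : IsOpen N) (hMN : M ⊆ N)
    (T : E n → (E n →L[ℝ] E n)) (hT : ContDiffOn ℝ 1 T N) (hTGr : ∀ y ∈ N, T y ∈ Gr d n)
    (hTM : ∀ y ∈ M, T y = tangentProj M y)
    -- the approximating varifolds `V_i = ‖V_i‖ ⊗ ν_i`
    (Vi : ℕ → Varifold d n Ω) (ν : ℕ → ProbabilityTheory.Kernel (E n) (E n →L[ℝ] E n))
    (hν : ∀ i, IsYoungMeasure (Vi i) (ν i))
    (ρ ξ : ℝ → ℝ) (hρξ : IsKernelPair n ρ ξ)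
    (x : E n) (hx : x ∈ M)
    (z : ℕ → E n) (hz : Tendsto z atTop (𝓝 x)) (hzsupp : ∀ i, z i ∈ (Vi i).supp)
    (η d₁ d₂ ε : ℕ → ℝ)
    (hη : (∀ i, 0 < η i) ∧ Antitone η ∧ Tendsto η atTop (𝓝 0))
    (hd₁ : (∀ i, 0 < d₁ i) ∧ Antitone d₁ ∧ Tendsto d₁ atTop (𝓝 0))
    (hd₂ : (∀ i, 0 < d₂ i) ∧ Antitone d₂ ∧ Tendsto d₂ atTop (𝓝 0))
    (hε : (∀ i, 0 < ε i) ∧ Antitone ε ∧ Tendsto ε atTop (𝓝 0))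
    -- the masses are close, on balls near `x` that are centered in the support of `‖V‖`
    (hmass : ∃ U ∈ 𝓝 x, ∀ i, ∀ y ∈ V.supp, ∀ r > 0,
      Metric.ball y r ⊆ Ω → Metric.ball y r ⊆ U →
        boundedLipschitzDist Ω (Metric.ball y r) V.mass (Vi i).mass ≤
          ENNReal.ofReal (d₁ i) *
            min (V.mass (Metric.thickening (η i) (Metric.ball y r)))
              ((Vi i).mass (Metric.thickening (η i) (Metric.ball y r))))
    -- the tangential parts are close
    (htan : ∀ i, ∀ y ∈ Metric.ball x (ε i + ‖x - z i‖) ∩ (Vi i).supp ∩ N,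
      ∫ S, ‖T y - S‖ ∂(ν i y) ≤ d₂ i) :
    -- the quantitative estimate
    ((fun i => d₁ i + η i + ‖x - z i‖) =o[atTop] ε →
      (∀ᶠ i in atTop, 0 < regularizedMass (Vi i) ξ (ε i) (z i) ∧
        0 < regularizedMass V ξ (ε i) x) ∧
      ∃ C > 0, ∀ i, 0 < regularizedMass (Vi i) ξ (ε i) (z i) →
        0 < regularizedMass V ξ (ε i) x →
        ‖orthApproxMeanCurvature (Vi i) (ν i) ρ ξ (ε i) (z i) -
            orthApproxMeanCurvature V (fun y => Measure.dirac (tangentProj M y)) ρ ξ (ε i) x‖ ≤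
          C * ((d₁ i + d₂ i + ‖x - z i‖) / ε i)) ∧
    -- the convergence
    ((fun i => d₁ i + d₂ i + η i + ‖x - z i‖) =o[atTop] ε →
      Tendsto (fun i => orthApproxMeanCurvature (Vi i) (ν i) ρ ξ (ε i) (z i)) atTop
        (𝓝 (meanCurvature M x))) := by
  obtain ⟨hε0, -, hεt⟩ := hε
  obtain ⟨hη0, -, -⟩ := hη
  obtain ⟨hd₁0, -, -⟩ := hd₁
  obtain ⟨hd₂0, -, -⟩ := hd₂
  obtain ⟨K, hK⟩ := hρξ.rho_deriv_lipschitz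
  obtain ⟨K', hξl⟩ := hρξ.xi_lipschitz
  have hρ : Differentiable ℝ ρ := hρξ.rho_contDiff.differentiable (by norm_num)
  have h0 : deriv ρ 0 = 0 := deriv_zero_of_even hρξ.rho_even
  have hξ0 : ∀ t, 1 ≤ t → ξ t = 0 := fun t ht =>
    eq_zero_of_tsupport hξl.continuous hρξ.xi_support ht
  have hCρ : 0 < kernelConst d ρ := kernelConst_pos hd hρ.continuous hρξ.rho_nonneg hρξ.rho_even
    (fun t ht => eq_zero_of_tsupport hρ.continuous hρξ.rho_support ht) hρξ.rho_integral
  have hCξ : 0 < kernelConst d ξ := kernelConst_pos hd hξl.continuous hρξ.xi_nonneg hρξ.xi_even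
    hξ0 hρξ.xi_integral
  -- Lipschitz bounds for the kernels
  set L : ℝ := K' + 1 with hLdef
  set L' : ℝ := 3 * K + 1 with hL'def
  have hL : 0 < L := by positivity
  have hL' : 0 < L' := by positivity
  have hξL : ∀ s t, |ξ s - ξ t| ≤ L * |s - t| := fun s t => by
    have := hξl.dist_le_mul s t
    rw [Real.dist_eq, Real.dist_eq] at this
    exact this.trans (mul_le_mul_of_nonneg_right (by linarith) (abs_nonneg _))
  have hξb : ∀ t, 0 ≤ t → |ξ t| ≤ L := fun t ht =>
    (abs_le_of_lipschitz_of_tsupport hξl hρξ.xi_support ht).trans (by linarith)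
  have hGl : ∀ u v : E n, ‖radialGrad ρ u - radialGrad ρ v‖ ≤ L' * ‖u - v‖ := fun u v =>
    (radialGrad_sub_le hK h0 u v).trans (mul_le_mul_of_nonneg_right (by linarith) (norm_nonneg _))
  have hGb : ∀ u : E n, ‖radialGrad ρ u‖ ≤ L' := fun u => by
    rw [norm_radialGrad u h0]
    have := abs_le_of_lipschitz_of_tsupport hK (tsupport_deriv_subset_Icc hρξ.rho_support)
      (norm_nonneg u)
    have hK0 : (0 : ℝ) ≤ K := K.2
    linarith
  have hG0 : ∀ w : E n, 1 ≤ ‖w‖ → radialGrad ρ w = 0 := fun w hw => by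
    simp [radialGrad,
      eq_zero_of_tsupport hK.continuous (tsupport_deriv_subset_Icc hρξ.rho_support) hw]
  have hGc : Continuous (radialGrad ρ : E n → E n) := continuous_of_lipschitz hL'.le hGl
  -- the submanifold near `x`
  have hxΩ : x ∈ Ω := hMΩ hx
  have hxN : x ∈ N := hMN hx
  have hMm : MeasurableSet M := hM.measurableSet
  have hm := IsUnitDensityVarifold.aemeasurable_tangentProj hMN hT.continuousOn hTM hMm
    (μHE[d] : Measure (E n))
  obtain ⟨ι, hιr, hι⟩ := blowUp hΩ hdn.le hM hMΩ hx (hV.mass_eq hm)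
  obtain ⟨C, hC, hmassε⟩ := exists_mass_bound hΩ hxΩ hι
  obtain ⟨κ, T₀, hκ, hT₀l, hT₀⟩ := exists_lipschitz_extension hN hxN hT
  have hT₀c : Continuous T₀ := continuous_of_lipschitz hκ.le hT₀l
  have hNx : ∀ᶠ y in 𝓝 x, y ∈ N := hN.mem_nhds hxN
  have hT₀M : ∀ᶠ y in 𝓝 x, y ∈ M → T₀ y = tangentProj M y := by
    filter_upwards [hT₀] with y hy hyM
    rw [hy, hTM y hyM]
  set P := tangentProj M x with hPdef
  have hTx : T₀ x = P := hT₀M.self_of_nhds hx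
  have hPstar : IsStarProjection P := by
    rw [hPdef, ← hTM x hx]
    exact (hTGr x hxN).1
  have hT' : HasFDerivAt T₀ (fderiv ℝ T x) x :=
    (((hT.contDiffAt (hN.mem_nhds hxN)).differentiableAt (by norm_num)).hasFDerivAt
      ).congr_of_eventuallyEq hT₀
  have hcurv := sum_normal_fderiv_eq_meanCurvature (T := T) hx hTM
    ((hT.contDiffAt (hN.mem_nhds hxN)).differentiableAt (by norm_num)).hasFDerivAt
    (hNx.mono fun y hy => (hTGr y hy).1.isIdempotentElem)
  obtain ⟨U, hU, hmass⟩ := hmass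
  have hΩx : ∀ᶠ y in 𝓝 x, y ∈ Ω := hΩ.mem_nhds hxΩ
  have hUx : ∀ᶠ y in 𝓝 x, y ∈ U := hU
  obtain ⟨r, hr, hrball⟩ := Metric.eventually_nhds_iff_ball.1
    ((hT₀.and hT₀M).and (hNx.and (hΩx.and hUx)))
  have hβ : ∀ᶠ t : ℝ in 𝓝[>] 0, (1 - P) (kernelVariation V ρ t x) =
      ∫ y, ((1 - P) * (T₀ y - P)) (radialGrad ρ (t⁻¹ • (y - x))) ∂V.mass := by
    filter_upwards [Ioo_mem_nhdsGT hr, hmassε] with t ht htm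
    exact normal_kernelVariation_eq hV hMm hm hPstar.isIdempotentElem
      (fun y hyM hy => (hrball y hy).1.2 hyM) hGc hGb hG0 ht.1 ht.2.le
      ((Metric.closedBall_subset_closedBall (by linarith [ht.1])).trans htm.1)
  have hαlim := tendsto_kernelMass (V := V) (x := x) hd hξl hρξ.xi_support hι
  have hαlow : ∀ᶠ t : ℝ in 𝓝[>] 0, kernelConst d ξ / 2 * t ^ d ≤ kernelMass V ξ t x := by
    filter_upwards [hαlim.eventually_const_lt (half_lt_self hCξ), self_mem_nhdsWithin]
      with t ht ht0
    have ht0' : 0 < t := ht0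
    rw [lt_inv_mul_iff₀ (by positivity)] at ht
    rw [mul_comm]
    exact ht.le
  have hxsupp : x ∈ V.supp := mem_supp_of_kernelMass_pos hξb hξ0 hxΩ (by
    filter_upwards [hαlow, self_mem_nhdsWithin] with t ht ht0
    have ht0' : 0 < t := ht0
    exact (by positivity : 0 < kernelConst d ξ / 2 * t ^ d).trans_le ht)
  have hε' : Tendsto ε atTop (𝓝[>] 0) :=
    tendsto_nhdsWithin_iff.2 ⟨hεt, Eventually.of_forall hε0⟩
  -- For V the rescaled mass α/ε^d is eventually at least C_ξ/2 = 2a; passing to V_i may lose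
  -- another a.
  set a : ℝ := kernelConst d ξ / 4 with ha
  have ha0 : 0 < a := by positivity
  set C' : ℝ := kernelConst d ξ / kernelConst d ρ * (2 * (1 + κ) * L' * C * a⁻¹ +
        (a⁻¹ * ((2 * L' + 4 * κ * L') * C) + 10 * a⁻¹ * a⁻¹ * L * κ * L' * C * C)) with hC'
  have hC'0 : 0 < C' := by positivity
  have hlimit : Tendsto (fun i => orthApproxMeanCurvature V
      (fun y => Measure.dirac (tangentProj M y)) ρ ξ (ε i) x) atTop (𝓝 (meanCurvature M x)) :=
    (tendsto_orthApproxMeanCurvature hΩ hd hx hxΩ hιr hι hρ h0 hK hρξ.rho_support hξl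
      hρξ.xi_support hCρ hCξ hT₀c hT₀M hT' hcurv hβ).comp hε'
  -- the estimates hold for all large indices
  have main : (fun i => d₁ i + η i + ‖x - z i‖) =o[atTop] ε →
      ∀ᶠ i in atTop, 0 < regularizedMass (Vi i) ξ (ε i) (z i) ∧
        0 < regularizedMass V ξ (ε i) x ∧
        ‖orthApproxMeanCurvature (Vi i) (ν i) ρ ξ (ε i) (z i) -
            orthApproxMeanCurvature V (fun y => Measure.dirac (tangentProj M y)) ρ ξ (ε i) x‖ ≤
          C' * ((d₁ i + d₂ i + ‖x - z i‖) / ε i) := by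
    intro ho
    -- The entry 1 puts d₁, η and |x - z| below ε; the other makes the error 2LCε⁻¹ε^d(d₁ + |x - z|)
    -- at most aε^d. Smallness of d₂ relative to ε plays no role.
    set θ : ℝ := min 1 (a / (2 * L * C)) with hθ
    have hθ0 : 0 < θ := lt_min one_pos (by positivity)
    have hsmall : ∀ᶠ i in atTop, ε i < min 1 (r / 5) := by
      exact hεt.eventually_lt_const (lt_min one_pos (by positivity))
    filter_upwards [ho.def hθ0, hsmall, hε'.eventually hmassε, hε'.eventually hβ,
      hε'.eventually hαlow] with i h1 h2 hm5 hβi hαi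
    have hεi := hε0 i
    have hd1 := hd₁0 i
    have hηi := hη0 i
    have hzn := norm_nonneg (x - z i)
    rw [Real.norm_eq_abs, Real.norm_eq_abs, abs_of_pos hεi, abs_of_pos (by positivity)] at h1
    have hθε : θ * ε i ≤ ε i := mul_le_of_le_one_left hεi.le (min_le_left _ _)
    have hε1 : ε i ≤ 1 := (h2.trans_le (min_le_left _ _)).le
    have hεr : 5 * ε i < r := by linarith [h2.trans_le (min_le_right 1 (r / 5))]
    have hzε : ‖x - z i‖ ≤ ε i := by linarith
    have hdε : d₁ i ≤ ε i := by linarith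
    have hηε : η i ≤ ε i := by linarith
    have h4 : ∀ y ∈ Metric.ball x (4 * ε i), y ∈ Metric.ball x r := fun y hy =>
      Metric.ball_subset_ball (by linarith) hy
    have hΔ : boundedLipschitzDist Ω (Metric.ball x (4 * ε i)) V.mass (Vi i).mass ≤
        ENNReal.ofReal (d₁ i * (C * ε i ^ d)) := by
      refine (hmass i x hxsupp (4 * ε i) (by positivity)
        (fun y hy => (hrball y (h4 y hy)).2.2.1) (fun y hy => (hrball y (h4 y hy)).2.2.2)).trans ?_
      rw [ENNReal.ofReal_mul hd1.le]
      gcongr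
      -- Since η ≤ ε, the thickened ball of radius 4ε lies in the closed ball of radius 5ε, whose
      -- ‖V‖-mass is at most Cε^d.
      refine (min_le_left _ _).trans ((measure_mono ?_).trans
        ((ofReal_measureReal (V.mass_closedBall_lt_top hm5.1).ne).symm.le.trans
          (ENNReal.ofReal_le_ofReal hm5.2)))
      refine (Metric.thickening_subset_cthickening _ _).trans ?_
      refine (Metric.cthickening_mono hηε _).trans ?_
      refine (Metric.cthickening_subset_of_subset _ Metric.ball_subset_closedBall).trans ?_
      rw [cthickening_closedBall hεi.le (by positivity)]
      exact Metric.closedBall_subset_closedBall (by linarith)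
    have hzball : ∀ y ∈ Metric.ball (z i) (ε i), y ∈ Metric.ball x (ε i + ‖x - z i‖) :=
      fun y hy => Metric.ball_subset_ball' (by rw [dist_comm, dist_eq_norm]) hy
    have hzr : ∀ y ∈ Metric.ball (z i) (ε i), y ∈ Metric.ball x r :=
      fun y hy => Metric.ball_subset_ball (by linarith) (hzball y hy)
    have hTν : ∀ y ∈ (Vi i).supp, y ∈ Metric.ball (z i) (ε i) →
        ∫ S, ‖T₀ y - S‖ ∂(ν i y) ≤ d₂ i := fun y hys hyb => by
      rw [(hrball y (hzr y hyb)).1.1]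
      exact htan i y ⟨⟨hzball y hyb, hys⟩, (hrball y (hzr y hyb)).2.1⟩
    have hαW : |kernelMass (Vi i) ξ (ε i) (z i) - kernelMass V ξ (ε i) x| ≤ a * ε i ^ d := by
      refine (abs_kernelMass_sub_le hΩ hεi hε1 hC.le hd1.le hdε hzε hm5.1 hm5.2 hΔ hL hξL hξb
        hξ0).trans ?_
      have hs : d₁ i + ‖x - z i‖ ≤ a / (2 * L * C) * ε i := by
        have : θ * ε i ≤ a / (2 * L * C) * ε i :=
          mul_le_mul_of_nonneg_right (min_le_right _ _) hεi.le
        linarith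
      refine (mul_le_mul_of_nonneg_left hs (by positivity)).trans (le_of_eq ?_)
      field_simp
    have hεd : 0 < ε i ^ d := by positivity
    have hα1 : a * ε i ^ d ≤ kernelMass V ξ (ε i) x := by
      refine le_trans ?_ hαi
      gcongr
      rw [ha]
      linarith
    have hα2 : a * ε i ^ d ≤ kernelMass (Vi i) ξ (ε i) (z i) := by
      have e2 : kernelConst d ξ / 2 * ε i ^ d = a * ε i ^ d + a * ε i ^ d := by rw [ha]; ring
      rw [e2] at hαi
      linarith [(abs_le.1 hαW).1]
    have hae : 0 < a * ε i ^ d := by positivity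
    refine ⟨(regularizedMass_pos_iff _ _ hεi _).2 (hae.trans_le hα2),
      (regularizedMass_pos_iff _ _ hεi _).2 (hae.trans_le hα1), ?_⟩
    rw [orthApproxMeanCurvature_dirac]
    refine norm_orthApproxMeanCurvature_sub_le hΩ (hν i) hρ h0 hεi hε1 hC.le hd1.le hdε
      (hd₂0 i).le hzε hm5.1 hm5.2 hΔ hL hξL hξb hξ0 hL' hGl hGb hG0 hκ hT₀l hTx hPstar ?_ ?_ hβi
      (by positivity) ha0 hα1 hα2
    · filter_upwards [(Vi i).ae_mem_supp hΩ] with y hy hyb using hTν y hy hyb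
    -- The Young measure is evaluated at the single point z_i, so an almost-everywhere bound would
    -- not do; this is where z_i being in the support enters.
    · exact hTν (z i) (hzsupp i) (Metric.mem_ball_self hεi)
  refine ⟨fun ho => ⟨(main ho).mono fun i h => ⟨h.1, h.2.1⟩, ?_⟩, fun ho => ?_⟩
  · obtain ⟨i₀, hi₀⟩ := eventually_atTop.1 (main ho)
    set D : ℕ → ℝ := fun i => ‖orthApproxMeanCurvature (Vi i) (ν i) ρ ξ (ε i) (z i) -
      orthApproxMeanCurvature V (fun y => Measure.dirac (tangentProj M y)) ρ ξ (ε i) x‖ with hD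
    set s : ℕ → ℝ := fun i => (d₁ i + d₂ i + ‖x - z i‖) / ε i with hs
    have hs0 : ∀ i, 0 < s i := fun i => by
      have := hd₁0 i
      have := hd₂0 i
      have := hε0 i
      positivity
    have hsum : 0 ≤ ∑ j ∈ Finset.range i₀, D j / s j :=
      Finset.sum_nonneg fun j _ => div_nonneg (norm_nonneg _) (hs0 j).le
    -- The finitely many indices before i₀ are absorbed by adding their ratios, which are finite
    -- because every s j is positive.
    refine ⟨C' + ∑ j ∈ Finset.range i₀, D j / s j, by positivity, fun i _ _ => ?_⟩
    change D i ≤ _ * s i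
    rcases lt_or_ge i i₀ with hi | hi
    · have h1 : D i / s i ≤ ∑ j ∈ Finset.range i₀, D j / s j :=
        Finset.single_le_sum (f := fun j => D j / s j)
          (fun j _ => div_nonneg (norm_nonneg _) (hs0 j).le) (Finset.mem_range.2 hi)
      rw [← div_le_iff₀ (hs0 i)]
      linarith
    · refine ((hi₀ i hi).2.2).trans ?_
      exact mul_le_mul_of_nonneg_right (by linarith) (hs0 i).le
  · have ho1 : (fun i => d₁ i + η i + ‖x - z i‖) =o[atTop] ε := by
      refine Asymptotics.IsBigO.trans_isLittleO (Asymptotics.IsBigO.of_bound 1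
        (Eventually.of_forall fun i => ?_)) ho
      have := hd₁0 i
      have := hd₂0 i
      have := hη0 i
      rw [one_mul, Real.norm_of_nonneg (by positivity), Real.norm_of_nonneg (by positivity)]
      linarith
    have ho2 : (fun i => d₁ i + d₂ i + ‖x - z i‖) =o[atTop] ε := by
      refine Asymptotics.IsBigO.trans_isLittleO (Asymptotics.IsBigO.of_bound 1
        (Eventually.of_forall fun i => ?_)) ho
      have := hd₁0 i
      have := hd₂0 i
      have := hη0 i
      rw [one_mul, Real.norm_of_nonneg (by positivity), Real.norm_of_nonneg (by positivity)]
      linarith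
    have hdiff : Tendsto (fun i => orthApproxMeanCurvature (Vi i) (ν i) ρ ξ (ε i) (z i) -
        orthApproxMeanCurvature V (fun y => Measure.dirac (tangentProj M y)) ρ ξ (ε i) x) atTop
        (𝓝 0) := by
      refine squeeze_zero_norm' ((main ho1).mono fun i h => h.2.2) ?_
      simpa using ho2.tendsto_div_nhds_zero.const_mul C'
    simpa using hdiff.add hlimit
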